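/- A *distribution* is a linear functional $\mu\colon\mathbb{C}[x]\to\mathbb{C}$. Let $(\mathcal{B},\varphi,\varphi')$ be an *infinitesimal noncommutative probability space* (ncps): a unital $\mathbb{C}$-algebra $\mathcal{B}$ with linear functionals $\varphi,\varphi'\colon\mathcal{B}\to\mathbb{C}$ such that $\varphi(1)=1$ and $\varphi'(1)=0$; if only $\varphi$ is given, $(\mathcal{B},\varphi)$ is a ncps. The distribution of $b\in\mathcal{B}$ with respect to $\varphi$ is $x^n\mapsto\varphi(b^n)$, $n\ge0$, and the infinitesimal distribution of $b$ is the pair of its distributions with respect to $\varphi$ and $\varphi'$. Elements $b_1,b_2$ are *free* if, for every $n\ge1$, all $i_1,\dots,i_n\in\{1,2\}$ with $i_k\ne i_{k+1}$, and all $c_k$ in the unital subalgebra generated by $b_{i_k}$ with $\varphi(c_k)=0$, one has $\varphi(c_1\cdots c_n)=0$. They are *infinitesimally free* if, for the same data, $\varphi(c_1\cdots c_n)=0$ and $$\varphi'(c_1\cdots c_n)=\varphi(c_1c_n)\,\varphi(c_2c_{n-1})\cdots\varphi(c_{(n-1)/2}\,c_{(n+3)/2})\;\varphi'(c_{(n+1)/2})$$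 if $n$ is odd and $i_k=i_{n+1-k}$ for all $k$, while $\varphi'(c_1\cdots c_n)=0$ otherwise. The free multiplicative convolution $\mu_1\boxtimes\mu_2$ is the distribution of $a_1a_2$ for free elements $a_1,a_2$ of a ncps with distributions $\mu_1,\mu_2$. The infinitesimal free multiplicative convolution $(\mu_1,\mu_1')\boxtimes(\mu_2,\mu_2')$ is the infinitesimal distribution of $b_1b_2$ for infinitesimally free elements $b_1,b_2$ of an infinitesimal ncps with infinitesimal distributions $(\mu_1,\mu_1'),(\mu_2,\mu_2')$. (Such elements exist, and the result does not depend on their choice.) The *inverse Markov–Krein transform* of a distribution $\mu$ with $\mu(1)=1$ is the unique distribution $\tau$ such that $$\frac{\mathrm{d}}{\mathrm{d}z}G_\mu(z)=-G_\tau(z)\,G_\mu(z),\qquad\text{where } G_\nu(z)=\sum_{n\ge0}\frac{\nu(x^n)}{z^{n+1}}$$ are formal series in $z^{-1}$. **Proposition.** Let $\mu_1,\mu_2$ be distributions with $\mu_1(1)=\mu_2(1)=1$, and let $\mu=\mu_1\boxtimes\mu_2$. Let $\tau_1,\tau_2,\tau$ be the inverse Markov–Krein transforms of $\mu_1,\mu_2,\mu$,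 respectively. Then $$(\mu_1,\mu_1-\tau_1)\boxtimes(\mu_2,\mu_2-\tau_2)=(\mu,\mu-\tau).$$ -/

import Mathlib

universe u v

namespace InfFree

/-! Throughout, a noncommutative probability space is a unital complex algebra `A` with a linear
functional `φ` such that `φ 1 = 1`; an infinitesimal one carries in addition a linear functional
`φ'` such that `φ' 1 = 0`. -/

/-- A distribution is a linear functional on the polynomials in one variable. -/
abbrev Distribution : Type := Polynomial ℂ →ₗ[ℂ] ℂ

/-- The distribution `xⁿ ↦ φ (bⁿ)` of the element `b` with respect to the functional `φ`. -/
noncomputable def law {B : Type u} [Ring B] [Algebra ℂ B] (φ : B →ₗ[ℂ] ℂ) (b : B) :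
    Distribution :=
  φ ∘ₗ (Polynomial.aeval b).toLinearMap

/-- The sequence of indices `i 0, …, i n` is alternating: neighbouring entries are distinct. -/
def Alternating {I : Type v} {n : ℕ} (i : Fin (n + 1) → I) : Prop :=
  ∀ k : Fin n, i k.castSucc ≠ i k.succ

/-- Freeness of a family of unital subalgebras with respect to `φ`: alternating products of
centered elements have vanishing expectation. The words have length `n + 1 ≥ 1`. -/
def Free {A : Type u} [Ring A] [Algebra ℂ A] (φ : A →ₗ[ℂ] ℂ)
    {I : Type v} (S : I → Subalgebra ℂ A) : Prop :=
  ∀ (n : ℕ) (i : Fin (n + 1) → I) (a : Fin (n + 1) → A),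
    Alternating i → (∀ k, a k ∈ S (i k)) → (∀ k, φ (a k) = 0) →
      φ (List.ofFn a).prod = 0

/-- Infinitesimal freeness of a family of unital subalgebras with respect to `(φ, φ')`.
The words have length `n + 1` and are indexed from `0`; the length is odd iff `n` is even, and then
the middle entry has index `n / 2`, and the entry opposite to `k` has index `k.rev = n - k`. -/
def InfinitesimallyFree {B : Type u} [Ring B] [Algebra ℂ B] (φ φ' : B →ₗ[ℂ] ℂ)
    {I : Type v} (S : I → Subalgebra ℂ B) : Prop :=
  ∀ (n : ℕ) (i : Fin (n + 1) → I) (b : Fin (n + 1) → B),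
    Alternating i → (∀ k, b k ∈ S (i k)) → (∀ k, φ (b k) = 0) →
      φ (List.ofFn b).prod = 0 ∧
      (Even n ∧ (∀ k, i k = i k.rev) →
        φ' (List.ofFn b).prod =
          (∏ k ∈ Finset.univ.filter (fun k : Fin (n + 1) => (k : ℕ) < n / 2), φ (b k * b k.rev)) *
            φ' (b ⟨n / 2, by omega⟩)) ∧
      (¬ (Even n ∧ ∀ k, i k = i k.rev) → φ' (List.ofFn b).prod = 0)

/-- The unital subalgebras generated by the elements `b₁` and by `b₂`. -/
def generated {B : Type u} [Ring B] [Algebra ℂ B] (b₁ b₂ : B) : Fin 2 → Subalgebra ℂ B :=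
  ![Algebra.adjoin ℂ {b₁}, Algebra.adjoin ℂ {b₂}]

/-- `a₁` and `a₂` are free elements of the noncommutative probability space `(A, φ)`, with
distributions `μ₁` and `μ₂`. -/
structure FreeRealization (μ₁ μ₂ : Distribution) {A : Type u} [Ring A] [Algebra ℂ A]
    (φ : A →ₗ[ℂ] ℂ) (a₁ a₂ : A) : Prop where
  unital : φ 1 = 1
  law_fst : law φ a₁ = μ₁
  law_snd : law φ a₂ = μ₂
  free : Free φ (generated a₁ a₂)

/-- `μ = μ₁ ⊠ μ₂`: free elements `a₁, a₂` with distributions `μ₁, μ₂` exist, and whenever such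
elements are given in a noncommutative probability space, `a₁ a₂` has distribution `μ`. -/
def IsFreeMulConv (μ₁ μ₂ μ : Distribution) : Prop :=
  (∃ (A : Type u) (_ : Ring A) (_ : Algebra ℂ A) (φ : A →ₗ[ℂ] ℂ) (a₁ a₂ : A),
    FreeRealization μ₁ μ₂ φ a₁ a₂) ∧
  ∀ (A : Type u) [Ring A] [Algebra ℂ A] (φ : A →ₗ[ℂ] ℂ) (a₁ a₂ : A),
    FreeRealization μ₁ μ₂ φ a₁ a₂ → law φ (a₁ * a₂) = μ

/-- `b₁` and `b₂` are infinitesimally free elements of the infinitesimal noncommutative probability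
space `(B, φ, φ')`, with infinitesimal distributions `ν₁` and `ν₂`. -/
structure InfFreeRealization (ν₁ ν₂ : Distribution × Distribution) {B : Type u} [Ring B]
    [Algebra ℂ B] (φ φ' : B →ₗ[ℂ] ℂ) (b₁ b₂ : B) : Prop where
  unital : φ 1 = 1
  unital' : φ' 1 = 0
  law_fst : (law φ b₁, law φ' b₁) = ν₁
  law_snd : (law φ b₂, law φ' b₂) = ν₂
  free : InfinitesimallyFree φ φ' (generated b₁ b₂)

/-- `ν = ν₁ ⊠ ν₂` (infinitesimal free multiplicative convolution): infinitesimally free elements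
`b₁, b₂` with infinitesimal distributions `ν₁, ν₂` exist, and whenever such elements are given in an
infinitesimal noncommutative probability space, `b₁ b₂` has infinitesimal distribution `ν`. -/
def IsInfFreeMulConv (ν₁ ν₂ ν : Distribution × Distribution) : Prop :=
  (∃ (B : Type u) (_ : Ring B) (_ : Algebra ℂ B) (φ φ' : B →ₗ[ℂ] ℂ) (b₁ b₂ : B),
    InfFreeRealization ν₁ ν₂ φ φ' b₁ b₂) ∧
  ∀ (B : Type u) [Ring B] [Algebra ℂ B] (φ φ' : B →ₗ[ℂ] ℂ) (b₁ b₂ : B),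
    InfFreeRealization ν₁ ν₂ φ φ' b₁ b₂ → (law φ (b₁ * b₂), law φ' (b₁ * b₂)) = ν

/-- The Cauchy transform `G_μ(z) = ∑ₙ μ(xⁿ) z⁻⁽ⁿ⁺¹⁾`, as a formal power series in `w = z⁻¹`. -/
noncomputable def cauchyTransform (μ : Distribution) : PowerSeries ℂ :=
  PowerSeries.X * PowerSeries.mk fun n => μ (Polynomial.X ^ n)

/-- The derivation `d/dz = - w² d/dw` on formal power series in `w = z⁻¹`. -/
noncomputable def derivZ (G : PowerSeries ℂ) : PowerSeries ℂ :=
  -(PowerSeries.X ^ 2 * PowerSeries.derivative ℂ G)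

/-- `τ` is the inverse Markov–Krein transform of `μ`: `d/dz G_μ(z) = - G_τ(z) G_μ(z)`. -/
def IsInverseMarkovKrein (μ τ : Distribution) : Prop :=
  derivZ (cauchyTransform μ) = -(cauchyTransform τ * cauchyTransform μ)

/-- The inverse Markov–Krein transform of a normalized distribution exists and is unique. -/
theorem existsUnique_inverseMarkovKrein (μ : Distribution) (h : μ 1 = 1) :
    ∃! τ : Distribution, IsInverseMarkovKrein μ τ := by
  set M : PowerSeries ℂ := PowerSeries.mk fun n => μ (Polynomial.X ^ n) with hM
  have hM0 : PowerSeries.constantCoeff M ≠ 0 := by simp [hM, h]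
  have key : ∀ τ : Distribution, IsInverseMarkovKrein μ τ ↔
      (PowerSeries.mk fun n => τ (Polynomial.X ^ n)) =
        PowerSeries.derivative ℂ (PowerSeries.X * M) * M⁻¹ := by
    intro τ
    rw [PowerSeries.eq_mul_inv_iff_mul_eq hM0]
    unfold IsInverseMarkovKrein derivZ cauchyTransform
    rw [← hM, neg_inj]
    have hX : (PowerSeries.X : PowerSeries ℂ) ^ 2 ≠ 0 := pow_ne_zero _ PowerSeries.X_ne_zero
    constructor
    · intro e
      apply mul_left_cancel₀ hX
      rw [e]; ring
    · intro e
      rw [← e]; ring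
  refine ⟨(Polynomial.basisMonomials ℂ).constr ℂ fun n => PowerSeries.coeff n
    (PowerSeries.derivative ℂ (PowerSeries.X * M) * M⁻¹), ?_, ?_⟩
  · refine (key _).2 (PowerSeries.ext fun n => ?_)
    have := (Polynomial.basisMonomials ℂ).constr_basis ℂ (fun n => PowerSeries.coeff n
      (PowerSeries.derivative ℂ (PowerSeries.X * M) * M⁻¹)) n
    simpa [Polynomial.coe_basisMonomials, Polynomial.monomial_one_right_eq_X_pow] using this
  · intro τ hτ
    refine (Polynomial.basisMonomials ℂ).ext fun n => ?_
    rw [Module.Basis.constr_basis, ← (key τ).1 hτ]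
    simp [Polynomial.monomial_one_right_eq_X_pow]

end InfFree

/-! Write M for a moment series. If the mean is nonzero, M - 1 has a compositional inverse χ = X h.
The resolvent r = (1 - χ x)⁻¹ then has mean 1 + X, so r = 1 + X + X v with v centered, and h x r = 1
+ v.

For two elements and w = X h₁ h₂ (1 + X), the terms linear in v₁, v₂ cancel in r₁ (1 - w b₁ b₂) r₂ =
1 + X - X v₁ v₂ (`resolvent_mul_factor`). The resolvent of b₁ b₂ at w is therefore r₂ g r₁ with g =
(1 + X - X v₁ v₂)⁻¹, a combination of 1 and alternating words in centered elements
(`exists_geometric`). Freeness leaves only the constant, so M(w) = 1 + X: this is multiplicativity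
of the S-transform. The functional φ' sees only the odd words g v₁ and v₂ g, and infinitesimal
freeness yields a 2 × 2 linear system for them with data φ(vᵢ²) and φ'(vᵢ) (`moments_mul_subst`).

The Markov–Krein relation is M_τ M_μ = (X M_μ)', whose right side is the mean of a squared
resolvent. Evaluated at χ it becomes (1 + X) φ'(v) = -X φ(v²) for φ' = μ - τ, while the chain rule
gives (1 + X + X φ(v²)) χ' = h (`exists_isCenteredResolvent`). With these the linear system is
solved in terms of w', and the solution is the Markov–Krein relation for the product.

Nonzero means are no restriction: adding a scalar s to both elements is compatible with
infinitesimal freeness and with the transform, and the moments of the product are continuous in s.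
Existence comes from operators on a space of words. -/

namespace InfFree

open scoped PowerSeries

/-! ### Functionals applied coefficientwise to power series -/

section Hat

variable {B : Type u} [Ring B] [Algebra ℂ B]

/-- The coefficientwise extension of a linear functional to formal power series. -/
noncomputable def hat (φ : B →ₗ[ℂ] ℂ) : B⟦X⟧ →+ ℂ⟦X⟧ where
  toFun f := PowerSeries.mk fun n => φ (PowerSeries.coeff n f)
  map_zero' := by ext; simp
  map_add' f g := by ext; simp

@[simp] theorem coeff_hat (φ : B →ₗ[ℂ] ℂ) (f : B⟦X⟧) (n : ℕ) :
    PowerSeries.coeff n (hat φ f) = φ (PowerSeries.coeff n f) := by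
  simp [hat]

variable (B) in
/-- Scalar power series as power series over a complex algebra. -/
noncomputable def scal : ℂ⟦X⟧ →+* B⟦X⟧ := PowerSeries.map (algebraMap ℂ B)

theorem coeff_scal (s : ℂ⟦X⟧) (n : ℕ) :
    PowerSeries.coeff n (scal B s) = algebraMap ℂ B (PowerSeries.coeff n s) := by
  simp [scal]

theorem scal_X : scal B PowerSeries.X = PowerSeries.X := by simp [scal]

theorem scal_commute (s : ℂ⟦X⟧) (f : B⟦X⟧) : scal B s * f = f * scal B s := by
  ext n
  rw [PowerSeries.coeff_mul, PowerSeries.coeff_mul, ← Finset.Nat.sum_antidiagonal_swap]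
  refine Finset.sum_congr rfl fun p _ => ?_
  simp only [coeff_scal, Prod.fst_swap, Prod.snd_swap]
  exact Algebra.commutes _ _

theorem hat_scal_mul (φ : B →ₗ[ℂ] ℂ) (s : ℂ⟦X⟧) (f : B⟦X⟧) :
    hat φ (scal B s * f) = s * hat φ f := by
  ext n
  rw [coeff_hat, PowerSeries.coeff_mul, PowerSeries.coeff_mul, map_sum]
  refine Finset.sum_congr rfl fun p _ => ?_
  rw [coeff_scal, coeff_hat, ← Algebra.smul_def, map_smul, smul_eq_mul]

theorem hat_C (φ : B →ₗ[ℂ] ℂ) (b : B) : hat φ (PowerSeries.C b) = PowerSeries.C (φ b) := by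
  ext n
  simp only [coeff_hat, PowerSeries.coeff_C]
  split_ifs <;> simp

theorem hat_scal (φ : B →ₗ[ℂ] ℂ) (s : ℂ⟦X⟧) :
    hat φ (scal B s) = s * PowerSeries.C (φ 1) := by
  have := hat_scal_mul φ s 1
  rwa [mul_one, ← map_one (PowerSeries.C (R := B)), hat_C] at this

theorem hat_sub (φ ψ : B →ₗ[ℂ] ℂ) (f : B⟦X⟧) : hat (φ - ψ) f = hat φ f - hat ψ f := by
  ext; simp

/-- Power series over polynomials, evaluated at an element of an algebra. -/
noncomputable def evalSeries (b : B) : (Polynomial ℂ)⟦X⟧ →+* B⟦X⟧ :=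
  PowerSeries.map (Polynomial.aeval b : Polynomial ℂ →ₐ[ℂ] B).toRingHom

theorem coeff_evalSeries (b : B) (f : (Polynomial ℂ)⟦X⟧) (n : ℕ) :
    PowerSeries.coeff n (evalSeries b f) = Polynomial.aeval b (PowerSeries.coeff n f) := by
  simp [evalSeries]

theorem hat_evalSeries (φ : B →ₗ[ℂ] ℂ) (b : B) (f : (Polynomial ℂ)⟦X⟧) :
    hat φ (evalSeries b f) = hat (law φ b) f := by
  ext n
  simp [coeff_evalSeries, law]

theorem evalSeries_scal (b : B) (s : ℂ⟦X⟧) : evalSeries b (scal _ s) = scal B s := by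
  ext n
  simp [coeff_evalSeries, coeff_scal]

theorem evalSeries_C (b : B) : evalSeries b (PowerSeries.C Polynomial.X) = PowerSeries.C b := by
  simp [evalSeries]

end Hat

/-! ### Resolvents and the Markov–Krein relation for moment series -/

section Substitution

/-- The generating series of the moments of a distribution. -/
noncomputable def moments (μ : Distribution) : ℂ⟦X⟧ :=
  PowerSeries.mk fun n => μ (Polynomial.X ^ n)

/-- The power series `α(X) x`, in which `x` is the variable of the polynomial ring. -/
noncomputable def dilate (α : ℂ⟦X⟧) : (Polynomial ℂ)⟦X⟧ :=
  scal _ α * PowerSeries.C Polynomial.X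

theorem hasSubst_dilate {α : ℂ⟦X⟧} (hα : PowerSeries.constantCoeff α = 0) :
    PowerSeries.HasSubst (dilate α) := by
  refine PowerSeries.HasSubst.of_constantCoeff_zero' ?_
  rw [dilate, map_mul, ← PowerSeries.coeff_zero_eq_constantCoeff_apply, coeff_scal]
  simp [hα]

theorem hat_subst_dilate (μ : Distribution) {α : ℂ⟦X⟧}
    (hα : PowerSeries.constantCoeff α = 0) (f : ℂ⟦X⟧) :
    hat μ (f.subst (dilate α)) = (PowerSeries.mk fun n =>
      PowerSeries.coeff n f * μ (Polynomial.X ^ n)).subst α := by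
  have hs := hasSubst_dilate hα
  have hs' := PowerSeries.HasSubst.of_constantCoeff_zero' hα
  ext n
  rw [coeff_hat, PowerSeries.coeff_subst' hs, PowerSeries.coeff_subst' hs',
    map_finsum _ (PowerSeries.coeff_subst_finite' hs f n)]
  refine finsum_congr fun d => ?_
  rw [dilate, mul_pow, ← map_pow, ← map_pow, PowerSeries.coeff_mul_C, coeff_scal,
    ← Algebra.smul_def, map_smul, map_smul, PowerSeries.coeff_mk]
  simp only [smul_eq_mul]
  ring

/-- The resolvent `(1 - α(X) x)⁻¹`. -/
noncomputable def resolvent (α : ℂ⟦X⟧) : (Polynomial ℂ)⟦X⟧ :=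
  (PowerSeries.mk fun _ => (1 : ℂ)).subst (dilate α)

theorem hat_resolvent (μ : Distribution) {α : ℂ⟦X⟧} (hα : PowerSeries.constantCoeff α = 0) :
    hat μ (resolvent α) = (moments μ).subst α := by
  simp [resolvent, hat_subst_dilate μ hα, moments]

theorem one_sub_dilate_mul_resolvent {α : ℂ⟦X⟧} (hα : PowerSeries.constantCoeff α = 0) :
    (1 - dilate α) * resolvent α = 1 := by
  have hs := hasSubst_dilate hα
  have h := congrArg (PowerSeries.substAlgHom (R := ℂ) hs) (PowerSeries.mk_one_mul_one_sub_eq_one ℂ)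
  rw [map_mul, map_sub, map_one, PowerSeries.substAlgHom_X, PowerSeries.coe_substAlgHom] at h
  rw [mul_comm]
  exact h

/-- The coefficients of (1 - X)⁻² are n + 1. The same factor arises in (X M)', so the squared
resolvent represents the right side of the Markov–Krein relation. -/
theorem hat_resolvent_sq (μ : Distribution) {α : ℂ⟦X⟧}
    (hα : PowerSeries.constantCoeff α = 0) :
    hat μ (resolvent α * resolvent α) =
      (PowerSeries.mk fun n => ((n : ℂ) + 1) * μ (Polynomial.X ^ n)).subst α := by
  have hs := hasSubst_dilate hα
  rw [resolvent, ← PowerSeries.subst_mul hs, hat_subst_dilate μ hα]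
  congr 1
  ext n
  simp [PowerSeries.coeff_mul]

theorem derivative_X_mul_moments (μ : Distribution) :
    PowerSeries.derivative ℂ (PowerSeries.X * moments μ) =
      PowerSeries.mk fun n => ((n : ℂ) + 1) * μ (Polynomial.X ^ n) := by
  ext n
  rw [PowerSeries.coeff_derivative, PowerSeries.coeff_succ_X_mul, moments]
  simp [mul_comm]

/-- With X = z⁻¹ both sides of the defining equation carry the factor X², which cancels. -/
theorem isInverseMarkovKrein_iff (μ τ : Distribution) :
    IsInverseMarkovKrein μ τ ↔
      moments τ * moments μ = PowerSeries.derivative ℂ (PowerSeries.X * moments μ) := by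
  have hX : (PowerSeries.X : ℂ⟦X⟧) ^ 2 ≠ 0 := pow_ne_zero _ PowerSeries.X_ne_zero
  unfold IsInverseMarkovKrein derivZ cauchyTransform
  rw [neg_inj]
  change PowerSeries.X ^ 2 * PowerSeries.derivative ℂ (PowerSeries.X * moments μ) =
    PowerSeries.X * moments τ * (PowerSeries.X * moments μ) ↔ _
  constructor
  · intro e
    apply mul_left_cancel₀ hX
    rw [e]; ring
  · intro e
    rw [← e]; ring

/-- The coefficientwise form is polynomial in the moments, as the continuity argument requires. -/
theorem isInverseMarkovKrein_iff_sum (μ τ : Distribution) :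
    IsInverseMarkovKrein μ τ ↔ ∀ n : ℕ, ∑ p ∈ Finset.HasAntidiagonal.antidiagonal n,
      τ (Polynomial.X ^ p.1) * μ (Polynomial.X ^ p.2) = ((n : ℂ) + 1) * μ (Polynomial.X ^ n) := by
  rw [isInverseMarkovKrein_iff, derivative_X_mul_moments, PowerSeries.ext_iff]
  simp [PowerSeries.coeff_mul, moments]

theorem IsInverseMarkovKrein.apply_one {μ τ : Distribution} (h : IsInverseMarkovKrein μ τ)
    (hμ : μ 1 = 1) : τ 1 = 1 := by
  simpa [hμ] using (isInverseMarkovKrein_iff_sum μ τ).1 h 0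

/-- Substitution of a power series of order one is injective. -/
theorem subst_injective {w : ℂ⟦X⟧} (h0 : PowerSeries.constantCoeff w = 0)
    (h1 : PowerSeries.coeff 1 w ≠ 0) :
    Function.Injective fun f : ℂ⟦X⟧ => f.subst w := by
  have hw := PowerSeries.HasSubst.of_constantCoeff_zero' h0
  have hi := PowerSeries.HasSubst.substInvOfIsUnit (P := w) h1.isUnit
  have key : ∀ f : ℂ⟦X⟧, PowerSeries.subst (w.substInvOfIsUnit h1.isUnit) (PowerSeries.subst w f) = f := fun f => by
    rw [PowerSeries.subst_comp_subst_apply hw hi, PowerSeries.subst_substInvOfIsUnit_right,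
      PowerSeries.X_subst]
    exact h0
  intro f g hfg
  rw [← key f, ← key g]
  exact congrArg (PowerSeries.subst _) hfg

end Substitution

/-! ### The centered resolvent of a distribution with nonzero mean -/

/-- The resolvent of a distribution `μ` in the variable `X` in which its moment series minus one
becomes `X`: then `h` is `X⁻¹` times the compositional inverse of this series, and
`(1 - X h x)⁻¹ = 1 + X + X v` with `v` centered. -/
structure IsCenteredResolvent (μ : Distribution) (h : ℂ⟦X⟧) (v : (Polynomial ℂ)⟦X⟧) : Prop where
  constantCoeff_ne_zero : PowerSeries.constantCoeff h ≠ 0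
  resolvent_eq : scal _ h * PowerSeries.C Polynomial.X *
    (1 + PowerSeries.X + PowerSeries.X * v) = 1 + v
  centered : hat μ v = 0

/-- Both identities compare two values of the mean of r²: (1 + X)² + X² μ(v²) from r = 1 + X + X v,
and (X M)' evaluated at χ. The first then uses the chain rule for M(χ) = 1 + X, the second the
Markov–Krein relation at χ. -/
theorem exists_isCenteredResolvent {μ : Distribution} (hμ : μ 1 = 1) (hm : μ Polynomial.X ≠ 0) :
    ∃ (h : ℂ⟦X⟧) (v : (Polynomial ℂ)⟦X⟧), IsCenteredResolvent μ h v ∧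
      (1 + PowerSeries.X + PowerSeries.X * hat μ (v * v)) *
        PowerSeries.derivative ℂ (PowerSeries.X * h) = h ∧
      ∀ τ : Distribution, IsInverseMarkovKrein μ τ →
        (1 + PowerSeries.X) * hat (μ - τ) v = -(PowerSeries.X * hat μ (v * v)) := by
  have hX : (PowerSeries.X : ℂ⟦X⟧) ≠ 0 := PowerSeries.X_ne_zero
  set ψ : ℂ⟦X⟧ := moments μ - 1 with hψ
  have hψ0 : PowerSeries.constantCoeff ψ = 0 := by simp [hψ, moments, hμ]
  have hψ1 : IsUnit (PowerSeries.coeff 1 ψ) := by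
    simpa [hψ, moments, PowerSeries.coeff_one] using hm
  set χ := ψ.substInvOfIsUnit hψ1 with hχ
  have hχ0 : PowerSeries.constantCoeff χ = 0 :=
    PowerSeries.constantCoeff_substInvOfIsUnit ψ hψ1
  have hs : PowerSeries.HasSubst χ := PowerSeries.HasSubst.substInvOfIsUnit ψ hψ1
  have hψχ : PowerSeries.subst χ ψ = PowerSeries.X :=
    PowerSeries.subst_substInvOfIsUnit_right ψ hψ0 hψ1
  have hone : PowerSeries.subst χ (1 : ℂ⟦X⟧) = 1 := by
    rw [← PowerSeries.coe_substAlgHom hs, map_one]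
  have hM : PowerSeries.subst χ (moments μ) = 1 + PowerSeries.X := by
    have : moments μ = 1 + ψ := by rw [hψ]; ring
    rw [this, PowerSeries.subst_add hs, hone, hψχ]
  -- In this normalization (1 + X) h is the S-transform.
  obtain ⟨h, hh⟩ := PowerSeries.X_dvd_iff.2 hχ0
  set r := resolvent χ with hr
  -- Here s = (r - 1) / X has mean 1, so the centered series v is s - 1.
  set s := scal _ h * PowerSeries.C Polynomial.X * r with hsdef
  have hdil : dilate χ = PowerSeries.X * (scal _ h * PowerSeries.C Polynomial.X) := by
    rw [dilate, hh, map_mul, scal_X, mul_assoc]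
  have hrs : r = 1 + PowerSeries.X * s := by
    have := one_sub_dilate_mul_resolvent hχ0
    rw [hdil] at this
    rw [hsdef]
    linear_combination this
  have hrv : 1 + PowerSeries.X + PowerSeries.X * (s - 1) = r := by rw [hrs]; ring
  have hat_X_mul : ∀ (ν : Distribution) (f : (Polynomial ℂ)⟦X⟧),
      hat ν (PowerSeries.X * f) = PowerSeries.X * hat ν f := fun ν f => by
    rw [← scal_X, hat_scal_mul]
  have hat_one : ∀ ν : Distribution, hat ν 1 = PowerSeries.C (ν 1) := fun ν => by
    rw [← map_one (PowerSeries.C (R := Polynomial ℂ)), hat_C]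
  have hat_X : ∀ ν : Distribution, hat ν PowerSeries.X = PowerSeries.X * PowerSeries.C (ν 1) :=
    fun ν => by rw [← hat_one, ← hat_X_mul, mul_one]
  have hcent : hat μ (s - 1) = 0 := by
    have h1 := hat_resolvent μ hχ0
    rw [← hr, ← hrv, map_add, map_add, hat_one, hat_X, hμ, hat_X_mul, hM] at h1
    refine (mul_eq_zero.1 ?_).resolve_left hX
    rw [map_one] at h1
    linear_combination h1
  have hsq : hat μ (r * r) = (1 + PowerSeries.X) ^ 2 +
      PowerSeries.X ^ 2 * hat μ ((s - 1) * (s - 1)) := by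
    have : r * r = scal _ ((1 + PowerSeries.X) ^ 2) +
        scal _ (2 * (1 + PowerSeries.X) * PowerSeries.X) * (s - 1) +
        scal _ (PowerSeries.X ^ 2) * ((s - 1) * (s - 1)) := by
      simp only [map_mul, map_pow, map_add, map_one, map_ofNat, scal_X]
      rw [← hrv]; ring
    rw [this, map_add, map_add, hat_scal_mul, hat_scal_mul, hat_scal, hcent, hμ, map_one]
    ring
  have hsq' := hat_resolvent_sq μ hχ0
  rw [← derivative_X_mul_moments, ← hr] at hsq'
  refine ⟨h, s - 1, ⟨?_, ?_, hcent⟩, ?_, ?_⟩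
  · have h1 : PowerSeries.coeff 1 χ = ((hψ1.unit⁻¹ : ℂˣ) : ℂ) :=
      PowerSeries.coeff_one_substInvOfIsUnit ψ hψ1
    have h2 : PowerSeries.coeff 1 χ = PowerSeries.constantCoeff h := by
      rw [hh, show (1 : ℕ) = 0 + 1 from rfl, PowerSeries.coeff_succ_X_mul,
        PowerSeries.coeff_zero_eq_constantCoeff_apply]
    rw [← h2, h1]
    exact Units.ne_zero _
  · rw [hrv, ← hsdef]; ring
  · have hder : (PowerSeries.derivative ℂ (moments μ)).subst χ *
        PowerSeries.derivative ℂ χ = 1 := by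
      rw [← PowerSeries.derivative_subst hs, hM]
      simp
    have e : hat μ (r * r) = 1 + PowerSeries.X +
        χ * (PowerSeries.derivative ℂ (moments μ)).subst χ := by
      rw [hsq', Derivation.leibniz, PowerSeries.derivative_X, smul_eq_mul, smul_eq_mul, mul_one,
        PowerSeries.subst_add hs, PowerSeries.subst_mul hs, PowerSeries.subst_X hs, hM]
      ring
    apply mul_left_cancel₀ hX
    rw [← hh]
    linear_combination (PowerSeries.derivative ℂ χ) * (e - hsq) + χ * hder
  · intro τ hτ
    have hτ1 := hτ.apply_one hμ
    have e := congrArg (PowerSeries.subst χ) ((isInverseMarkovKrein_iff μ τ).1 hτ)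
    rw [← hsq', PowerSeries.subst_mul hs, hM, ← hat_resolvent τ hχ0, ← hr, hsq] at e
    have e2 : hat μ r = 1 + PowerSeries.X := by rw [hr, hat_resolvent μ hχ0, hM]
    have e3 : hat (μ - τ) r = PowerSeries.X * hat (μ - τ) (s - 1) := by
      rw [← hrv, map_add, map_add, hat_one, hat_X, hat_X_mul]
      simp [hμ, hτ1]
    rw [hat_sub, e2] at e3
    apply mul_left_cancel₀ hX
    linear_combination (-(1 + PowerSeries.X)) * e3 - e

/-! ### Noncommutative factorization of the resolvent of a product -/

theorem smul_one_add_mul_mul {R A : Type*} [CommRing R] [Ring A] [Algebra R A] (t : R)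
    (v₁ v₂ g : A) :
    ((1 + t) • 1 + t • v₂) * g * ((1 + t) • 1 + t • v₁) =
      (1 + t) ^ 2 • g + ((1 + t) * t) • (g * v₁ + v₂ * g) + t ^ 2 • (v₂ * (g * v₁)) := by
  simp only [mul_add, add_mul, mul_one, one_mul, mul_smul_comm, smul_mul_assoc, mul_assoc]
  module

/-- Factorization of the resolvent of a product. -/
theorem resolvent_mul_factor {R A : Type*} [CommRing R] [Ring A] [Algebra R A] {t h₁ h₂ : R}
    {b₁ b₂ v₁ v₂ g r₁ r₂ : A} (hr₁ : r₁ = (1 + t) • 1 + t • v₁) (hr₂ : r₂ = (1 + t) • 1 + t • v₂)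
    (e₁ : h₁ • (b₁ * r₁) = 1 + v₁) (e₁' : h₁ • (r₁ * b₁) = 1 + v₁)
    (e₂ : h₂ • (b₂ * r₂) = 1 + v₂) (hg : ((1 + t) • 1 - t • (v₁ * v₂)) * g = 1) :
    (1 - (t * h₁ * h₂ * (1 + t)) • (b₁ * b₂)) * (r₂ * g * r₁) = 1 := by
  have k₁ : (1 - (t * h₁) • b₁) * r₁ = 1 := by
    rw [sub_mul, one_mul, smul_mul_assoc, mul_smul, e₁, hr₁]
    module
  have k₁' : r₁ * (1 - (t * h₁) • b₁) = 1 := by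
    rw [mul_sub, mul_one, mul_smul_comm, mul_smul, e₁', hr₁]
    module
  -- The substitutions leave r₁ r₂ - t (1 + t) (1 + v₁) (1 + v₂); the factor 1 + t is what cancels
  -- the terms linear in v₁ and v₂.
  have k : r₁ * (1 - (t * h₁ * h₂ * (1 + t)) • (b₁ * b₂)) * r₂ =
      (1 + t) • 1 - t • (v₁ * v₂) := by
    have : r₁ * (1 - (t * h₁ * h₂ * (1 + t)) • (b₁ * b₂)) * r₂ =
        r₁ * r₂ - (t * (1 + t)) • ((h₁ • (r₁ * b₁)) * (h₂ • (b₂ * r₂))) := by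
      simp only [mul_sub, sub_mul, mul_one, mul_smul_comm, smul_mul_assoc, smul_smul, mul_assoc]
      congr 2
      ring
    rw [this, e₁', e₂, hr₁, hr₂]
    simp only [mul_add, add_mul, mul_one, one_mul, mul_smul_comm, smul_mul_assoc]
    module
  calc (1 - (t * h₁ * h₂ * (1 + t)) • (b₁ * b₂)) * (r₂ * g * r₁)
      = ((1 - (t * h₁) • b₁) * r₁) * (1 - (t * h₁ * h₂ * (1 + t)) • (b₁ * b₂)) *
          (r₂ * g * r₁) := by rw [k₁, one_mul]
    _ = (1 - (t * h₁) • b₁) * ((r₁ * (1 - (t * h₁ * h₂ * (1 + t)) • (b₁ * b₂)) * r₂) * g) *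
          r₁ := by simp only [mul_assoc]
    _ = 1 := by rw [k, hg, mul_one, k₁]

/-! ### Alternating words over two indices -/

/-- The product `f 0 * f 1 * ⋯ * f n`. -/
def word {M : Type u} [Mul M] : ℕ → (ℕ → M) → M
  | 0, f => f 0
  | n + 1, f => f 0 * word n fun k => f (k + 1)

theorem word_succ_right {M : Type u} [Semigroup M] (n : ℕ) (f : ℕ → M) :
    word (n + 1) f = word n f * f (n + 1) := by
  induction n generalizing f with
  | zero => rfl
  | succ n ih =>
    rw [word, ih, ← mul_assoc]
    rfl

theorem word_congr {M : Type u} [Mul M] {n : ℕ} {f g : ℕ → M} (h : ∀ k ≤ n, f k = g k) :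
    word n f = word n g := by
  induction n generalizing f g with
  | zero => exact h 0 le_rfl
  | succ n ih => rw [word, word, h 0 (by omega), ih fun k hk => h (k + 1) (by omega)]

theorem word_update {M : Type u} [Semigroup M] (n : ℕ) (b : M) (f : ℕ → M) :
    word (n + 1) (Function.update f (n + 1) b) = word n f * b := by
  rw [word_succ_right, Function.update_self]
  congr 1
  exact word_congr fun k hk => by rw [Function.update_of_ne (by omega)]

theorem prod_ofFn_eq_word {M : Type u} [Monoid M] (n : ℕ) (f : ℕ → M) :
    (List.ofFn fun k : Fin (n + 1) => f k).prod = word n f := by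
  induction n generalizing f with
  | zero => simp [word]
  | succ n ih =>
    rw [List.ofFn_succ, List.prod_cons, word, ← ih]
    simp

/-- The product of pairings of opposite entries of `f 0, …, f n` and a weight of the middle
entry. -/
def pairing {α : Type u} (G : α → α → ℂ) (g : α → ℂ) (n : ℕ) (f : ℕ → α) : ℂ :=
  (∏ k ∈ Finset.range (n / 2), G (f k) (f (n - k))) * g (f (n / 2))

theorem pairing_add_two {α : Type u} (G : α → α → ℂ) (g : α → ℂ) (n : ℕ) (f : ℕ → α) :
    pairing G g (n + 2) f = G (f 0) (f (n + 2)) * pairing G g n fun k => f (k + 1) := by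
  have h : (n + 2) / 2 = n / 2 + 1 := by omega
  rw [pairing, pairing, h, Finset.prod_range_succ', mul_comm (∏ _ ∈ _, _), mul_assoc]
  congr 2
  refine Finset.prod_congr rfl fun k _ => ?_
  rw [show n + 2 - (k + 1) = n - k + 1 by have := Finset.mem_range.1 ‹_›; omega]

theorem pairing_congr {α : Type u} (G : α → α → ℂ) (g : α → ℂ) {n : ℕ} {f f' : ℕ → α}
    (h : ∀ k ≤ n, f k = f' k) : pairing G g n f = pairing G g n f' := by
  rw [pairing, pairing, h (n / 2) (by omega)]
  congr 1
  refine Finset.prod_congr rfl fun k hk => ?_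
  have := Finset.mem_range.1 hk
  rw [h k (by omega), h (n - k) (by omega)]

/-- The alternating sequence of indices starting with `i`. -/
def alt (i : Fin 2) (k : ℕ) : Fin 2 := if Even k then i else i + 1

@[simp] theorem alt_zero (i : Fin 2) : alt i 0 = i := by simp [alt]

theorem add_one_add_one (i : Fin 2) : i + 1 + 1 = i := by
  revert i; decide

theorem add_one_ne (i : Fin 2) : i + 1 ≠ i := by
  revert i; decide

theorem eq_add_one_of_ne {i j : Fin 2} (h : i ≠ j) : j = i + 1 := by
  revert i j; decide

theorem alt_succ (i : Fin 2) (k : ℕ) : alt i (k + 1) = alt (i + 1) k := by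
  unfold alt
  by_cases h : Even k
  · simp [h, Nat.even_add_one]
  · simp [h, Nat.even_add_one, add_one_add_one]

theorem alt_succ' (i : Fin 2) (k : ℕ) : alt i (k + 1) = alt i k + 1 := by
  unfold alt
  by_cases h : Even k
  · simp [h, Nat.even_add_one]
  · simp [h, Nat.even_add_one, add_one_add_one]

theorem alternating_alt (n : ℕ) (i : Fin 2) :
    Alternating fun k : Fin (n + 1) => alt i k := by
  intro k
  simp only [Fin.val_castSucc, Fin.val_succ, alt_succ']
  exact (add_one_ne _).symm

theorem Alternating.eq_alt {n : ℕ} {i : Fin (n + 1) → Fin 2} (h : Alternating i)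
    (k : Fin (n + 1)) : i k = alt (i 0) k := by
  induction k using Fin.induction with
  | zero => simp
  | succ k ih =>
    rw [eq_add_one_of_ne (h k), ih, Fin.val_succ, alt_succ', Fin.val_castSucc]

/-- With only two indices the palindrome condition is automatic for odd length, since k and n - k
then have the same parity. -/
theorem Alternating.palindromic_iff {n : ℕ} {i : Fin (n + 1) → Fin 2} (hi : Alternating i) :
    (Even n ∧ ∀ k, i k = i k.rev) ↔ Even n := by
  refine ⟨fun h => h.1, fun h => ⟨h, fun k => ?_⟩⟩
  have : Even (k.rev : ℕ) ↔ Even (k : ℕ) := by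
    rw [Fin.val_rev, show n + 1 - (k + 1) = n - (k : ℕ) by omega,
      Nat.even_sub (by omega)]
    simp [h]
  rw [hi.eq_alt k, hi.eq_alt k.rev]
  simp only [alt, this]

/-! ### Infinitesimal freeness in terms of sequences -/

section Centered

variable {B : Type u} [Ring B] [Algebra ℂ B]

/-- The centered elements of the subalgebra `S i`. -/
def centered (φ : B →ₗ[ℂ] ℂ) (S : Fin 2 → Subalgebra ℂ B) (i : Fin 2) : Submodule ℂ B :=
  Subalgebra.toSubmodule (S i) ⊓ LinearMap.ker φ

theorem mem_centered {φ : B →ₗ[ℂ] ℂ} {S : Fin 2 → Subalgebra ℂ B} {i : Fin 2} {b : B} :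
    b ∈ centered φ S i ↔ b ∈ S i ∧ φ b = 0 := by
  simp [centered]

theorem prod_filter_lt_eq_range {M : Type v} [CommMonoid M] (n m : ℕ) (h : m ≤ n)
    (F : Fin n → M) (F' : ℕ → M) (hF : ∀ k : Fin n, F k = F' k) :
    ∏ k ∈ Finset.univ.filter (fun k : Fin n => (k : ℕ) < m), F k =
      ∏ k ∈ Finset.range m, F' k := by
  refine Finset.prod_nbij (fun k => (k : ℕ)) (by simp) (fun a _ b _ hab => Fin.ext hab) ?_
    fun k _ => hF k
  intro k hk
  have hk' : k < m := by simpa using hk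
  exact ⟨⟨k, by omega⟩, by simpa using hk', rfl⟩

/-- For two subalgebras, infinitesimal freeness is a statement about sequences of centered
elements of alternating subalgebras. -/
theorem infinitesimallyFree_iff (φ φ' : B →ₗ[ℂ] ℂ) (S : Fin 2 → Subalgebra ℂ B) :
    InfinitesimallyFree φ φ' S ↔ ∀ (n : ℕ) (i : Fin 2) (f : ℕ → B),
      (∀ k, f k ∈ centered φ S (alt i k)) → φ (word n f) = 0 ∧
        φ' (word n f) =
          if Even n then pairing (fun x y => φ (x * y)) φ' n f else 0 := by
  have hprod : ∀ (n : ℕ) (f : ℕ → B),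
      (∏ k ∈ Finset.univ.filter (fun k : Fin (n + 1) => (k : ℕ) < n / 2),
        φ (f k * f k.rev)) * φ' (f (n / 2)) = pairing (fun x y => φ (x * y)) φ' n f := by
    intro n f
    rw [pairing, prod_filter_lt_eq_range (n + 1) (n / 2) (by omega) _
      fun k => φ (f k * f (n - k))]
    intro k
    rw [Fin.val_rev, show n + 1 - (k + 1) = n - (k : ℕ) by omega]
  constructor
  · intro h n i f hf
    obtain ⟨h1, h2, h3⟩ := h n (fun k => alt i k) (fun k => f k) (alternating_alt n i)
      (fun k => (mem_centered.1 (hf k)).1) fun k => (mem_centered.1 (hf k)).2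
    rw [prod_ofFn_eq_word] at h1 h2 h3
    rw [(alternating_alt n i).palindromic_iff] at h2 h3
    refine ⟨h1, ?_⟩
    split_ifs with hn
    · rw [h2 hn]
      exact hprod n f
    · exact h3 hn
  · intro h n i b hi hb hφ
    -- Padding by 0 is harmless because 0 is centered in both subalgebras.
    set f : ℕ → B := fun k => if hk : k < n + 1 then b ⟨k, hk⟩ else 0 with hf
    have hfb : ∀ k : Fin (n + 1), f k = b k := fun k => dif_pos k.2
    have hfc : ∀ k, f k ∈ centered φ S (alt (i 0) k) := by
      intro k
      by_cases hk : k < n + 1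
      · have := hi.eq_alt ⟨k, hk⟩
        rw [show f k = b ⟨k, hk⟩ from hfb ⟨k, hk⟩, ← this]
        exact mem_centered.2 ⟨hb _, hφ _⟩
      · rw [show f k = 0 from dif_neg hk]
        exact Submodule.zero_mem _
    have hb' : b = fun k : Fin (n + 1) => f k := funext fun k => (hfb k).symm
    obtain ⟨h1, h2⟩ := h n (i 0) f hfc
    rw [hi.palindromic_iff]
    rw [hb', prod_ofFn_eq_word]
    refine ⟨h1, fun hn => ?_, fun hn => ?_⟩
    · rw [h2, if_pos hn, ← hprod]
    · rw [h2, if_neg hn]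

end Centered

/-! ### Spans of alternating centered words -/

section Words

variable {B : Type u} [Ring B] [Algebra ℂ B]

/-- The span of the alternating words in centered elements whose first letter belongs to `S i`;
the words have odd length if `e` holds and even length otherwise. -/
def words (φ : B →ₗ[ℂ] ℂ) (S : Fin 2 → Subalgebra ℂ B) (i : Fin 2) (e : Prop) :
    Submodule ℂ B :=
  Submodule.span ℂ {b | ∃ (n : ℕ) (f : ℕ → B), (Even n ↔ e) ∧
    (∀ k, f k ∈ centered φ S (alt i k)) ∧ b = word n f}

variable {φ φ' : B →ₗ[ℂ] ℂ} {S : Fin 2 → Subalgebra ℂ B} {i : Fin 2} {e : Prop}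

theorem word_mem_words {n : ℕ} {f : ℕ → B} (hf : ∀ k, f k ∈ centered φ S (alt i k))
    (he : Even n ↔ e) : word n f ∈ words φ S i e :=
  Submodule.subset_span ⟨n, f, he, hf, rfl⟩

/-- Prepends a letter to a sequence. -/
def consSeq (b : B) (f : ℕ → B) : ℕ → B
  | 0 => b
  | k + 1 => f k

theorem consSeq_mem {b : B} {f : ℕ → B} (hb : b ∈ centered φ S i)
    (hf : ∀ k, f k ∈ centered φ S (alt (i + 1) k)) (k : ℕ) :
    consSeq b f k ∈ centered φ S (alt i k) := by
  cases k with
  | zero => simpa [consSeq] using hb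
  | succ k => rw [alt_succ]; exact hf k

theorem update_mem {n : ℕ} {b : B} {f : ℕ → B} (hb : b ∈ centered φ S (alt i n))
    (hf : ∀ k, f k ∈ centered φ S (alt i k)) (k : ℕ) :
    Function.update f n b k ∈ centered φ S (alt i k) := by
  by_cases h : k = n
  · subst h; simpa using hb
  · simpa [h] using hf k

theorem centered_le_words : centered φ S i ≤ words φ S i True := by
  intro b hb
  have hb' : ∀ k, consSeq b (fun _ => (0 : B)) k ∈ centered φ S (alt i k) :=
    consSeq_mem hb fun k => Submodule.zero_mem _
  exact word_mem_words (n := 0) hb' (by simp)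

theorem mul_mem_words {b y : B} (hb : b ∈ centered φ S i) (hy : y ∈ words φ S (i + 1) e) :
    b * y ∈ words φ S i (¬ e) := by
  refine Submodule.span_induction (p := fun y _ => b * y ∈ words φ S i (¬ e)) ?_ (by simp)
    (fun x y _ _ hx hy => by rw [mul_add]; exact Submodule.add_mem _ hx hy)
    (fun c x _ hx => by rw [mul_smul_comm]; exact Submodule.smul_mem _ c hx) hy
  rintro _ ⟨n, f, he, hf, rfl⟩
  exact word_mem_words (n := n + 1) (consSeq_mem hb hf) (by rw [Nat.even_add_one, he])

/-- First index and parity of the length determine which index may follow the last letter; `hj`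
records it. -/
theorem words_mul_mem {b y : B} {j : Fin 2} (hy : y ∈ words φ S i e)
    (hj : ∀ n, (Even n ↔ e) → alt i (n + 1) = j) (hb : b ∈ centered φ S j) :
    y * b ∈ words φ S i (¬ e) := by
  refine Submodule.span_induction (p := fun y _ => y * b ∈ words φ S i (¬ e)) ?_ (by simp)
    (fun x y _ _ hx hy => by rw [add_mul]; exact Submodule.add_mem _ hx hy)
    (fun c x _ hx => by rw [smul_mul_assoc]; exact Submodule.smul_mem _ c hx) hy
  rintro _ ⟨n, f, he, hf, rfl⟩
  rw [← word_update]
  exact word_mem_words (update_mem (by rwa [hj n he]) hf) (by rw [Nat.even_add_one, he])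

theorem apply_words_eq_zero (H : InfinitesimallyFree φ φ' S) {y : B} (hy : y ∈ words φ S i e) :
    φ y = 0 := by
  refine Submodule.span_induction (p := fun y _ => φ y = 0) ?_ (by simp)
    (fun x y _ _ hx hy => by rw [map_add, hx, hy, add_zero])
    (fun c x _ hx => by rw [map_smul, hx, smul_zero]) hy
  rintro _ ⟨n, f, he, hf, rfl⟩
  exact ((infinitesimallyFree_iff φ φ' S).1 H n i f hf).1

theorem apply_even_words_eq_zero (H : InfinitesimallyFree φ φ' S) {y : B}
    (hy : y ∈ words φ S i False) : φ' y = 0 := by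
  refine Submodule.span_induction (p := fun y _ => φ' y = 0) ?_ (by simp)
    (fun x y _ _ hx hy => by rw [map_add, hx, hy, add_zero])
    (fun c x _ hx => by rw [map_smul, hx, smul_zero]) hy
  rintro _ ⟨n, f, he, hf, rfl⟩
  rw [((infinitesimallyFree_iff φ φ' S).1 H n i f hf).2, if_neg (by simpa using he)]

/-- The outermost pair splits off the palindromic product (`pairing_add_two`); linearity passes to
spans. -/
theorem apply_mul_mul (H : InfinitesimallyFree φ φ' S) {b c y : B} (hb : b ∈ centered φ S i)
    (hc : c ∈ centered φ S i) (hy : y ∈ words φ S (i + 1) True) :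
    φ' (b * y * c) = φ (b * c) * φ' y := by
  refine Submodule.span_induction (p := fun y _ => φ' (b * y * c) = φ (b * c) * φ' y) ?_ (by simp)
    (fun x y _ _ hx hy => by rw [mul_add, add_mul, map_add, map_add, hx, hy, mul_add])
    (fun r x _ hx => by
      rw [mul_smul_comm, smul_mul_assoc, map_smul, map_smul, hx, smul_eq_mul, smul_eq_mul,
        mul_left_comm]) hy
  rintro _ ⟨n, f, he, hf, rfl⟩
  have hn : Even n := by simpa using he
  have hn2 : Even (n + 2) := by simpa [Nat.even_add] using hn
  have hf' := consSeq_mem hb hf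
  have hc' : c ∈ centered φ S (alt i (n + 2)) := by simpa [alt, hn2] using hc
  have hu := update_mem hc' hf'
  have e1 : b * word n f * c = word (n + 2) (Function.update (consSeq b f) (n + 2) c) := by
    rw [word_update]; rfl
  rw [e1, ((infinitesimallyFree_iff φ φ' S).1 H _ i _ hu).2, if_pos hn2, pairing_add_two,
    ((infinitesimallyFree_iff φ φ' S).1 H n (i + 1) f hf).2, if_pos hn]
  congr 1
  · simp [consSeq]
  · refine pairing_congr _ _ fun k hk => ?_
    rw [Function.update_of_ne (by omega)]
    rfl

end Words

/-! ### Power series with coefficients in spans of words -/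

section Series

variable {B : Type u} [Ring B] [Algebra ℂ B]

/-- All coefficients of the power series `f` belong to `V`. -/
def CoeffsIn (V : Submodule ℂ B) (f : B⟦X⟧) : Prop := ∀ n, PowerSeries.coeff n f ∈ V

theorem CoeffsIn.mul {U V W : Submodule ℂ B} (h : ∀ a ∈ U, ∀ b ∈ V, a * b ∈ W) {f g : B⟦X⟧}
    (hf : CoeffsIn U f) (hg : CoeffsIn V g) : CoeffsIn W (f * g) := by
  intro n
  rw [PowerSeries.coeff_mul]
  exact Submodule.sum_mem _ fun p _ => h _ (hf _) _ (hg _)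

theorem CoeffsIn.hat_eq_zero {V : Submodule ℂ B} {φ : B →ₗ[ℂ] ℂ} (h : ∀ b ∈ V, φ b = 0)
    {f : B⟦X⟧} (hf : CoeffsIn V f) : hat φ f = 0 := by
  ext n
  rw [coeff_hat, h _ (hf n), map_zero]

/-- A trilinear factorization rule extends to power series. -/
theorem hat_mul_mul {φ φ' : B →ₗ[ℂ] ℂ} {U V : Submodule ℂ B}
    (h : ∀ b ∈ U, ∀ c ∈ U, ∀ y ∈ V, φ' (b * y * c) = φ (b * c) * φ' y)
    {f g Y : B⟦X⟧} (hf : CoeffsIn U f) (hg : CoeffsIn U g) (hY : CoeffsIn V Y) :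
    hat φ' (f * Y * g) = hat φ (f * g) * hat φ' Y := by
  ext n
  rw [coeff_hat, PowerSeries.coeff_mul, PowerSeries.coeff_mul, map_sum]
  simp only [PowerSeries.coeff_mul, coeff_hat, map_sum, Finset.sum_mul]
  simp only [h _ (hf _) _ (hg _) _ (hY _)]
  rw [Finset.sum_sigma', Finset.sum_sigma']
  -- Both sums run over the exponents of f, Y, g, grouped as ((f, Y), g) and as ((f, g), Y).
  -- Exchanging the roles of Y and g is its own inverse.
  refine Finset.sum_nbij'
    (fun x => (⟨(x.2.1 + x.1.2, x.2.2), (x.2.1, x.1.2)⟩ : (_ : ℕ × ℕ) × (ℕ × ℕ)))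
    (fun x => (⟨(x.2.1 + x.1.2, x.2.2), (x.2.1, x.1.2)⟩ : (_ : ℕ × ℕ) × (ℕ × ℕ)))
    ?_ ?_ ?_ ?_ ?_
  · rintro ⟨⟨a, b⟩, ⟨c, d⟩⟩ h
    simp only [Finset.mem_sigma, Finset.HasAntidiagonal.mem_antidiagonal] at h ⊢
    refine ⟨?_, trivial⟩
    omega
  · rintro ⟨⟨a, b⟩, ⟨c, d⟩⟩ h
    simp only [Finset.mem_sigma, Finset.HasAntidiagonal.mem_antidiagonal] at h ⊢
    refine ⟨?_, trivial⟩
    omega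
  · rintro ⟨⟨a, b⟩, ⟨c, d⟩⟩ h
    simp only [Finset.mem_sigma, Finset.HasAntidiagonal.mem_antidiagonal] at h
    simp [h.2]
  · rintro ⟨⟨a, b⟩, ⟨c, d⟩⟩ h
    simp only [Finset.mem_sigma, Finset.HasAntidiagonal.mem_antidiagonal] at h
    simp [h.2]
  · rintro ⟨⟨a, b⟩, ⟨c, d⟩⟩ h
    rfl

/-- The geometric series in a product of two series of centered elements. -/
theorem exists_geometric {φ : B →ₗ[ℂ] ℂ} {S : Fin 2 → Subalgebra ℂ B} {i : Fin 2}
    {v₁ v₂ : B⟦X⟧} (h₁ : CoeffsIn (centered φ S i) v₁)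
    (h₂ : CoeffsIn (centered φ S (i + 1)) v₂) :
    ∃ g : B⟦X⟧, (1 + PowerSeries.X - PowerSeries.X * (v₁ * v₂)) * g = 1 ∧
      g * (1 + PowerSeries.X - PowerSeries.X * (v₁ * v₂)) = 1 ∧
      CoeffsIn (words φ S i False) (v₁ * v₂ * g) ∧ CoeffsIn (words φ S i True) (g * v₁) ∧
      CoeffsIn (words φ S (i + 1) True) (v₂ * g) ∧
      CoeffsIn (words φ S (i + 1) False) (v₂ * (g * v₁)) := by
  set a : B⟦X⟧ := 1 + PowerSeries.X - PowerSeries.X * (v₁ * v₂) with ha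
  have ha1 : PowerSeries.constantCoeff a = ((1 : Bˣ) : B) := by simp [ha]
  set g := PowerSeries.invOfUnit a 1 with hg
  have hag : a * g = 1 := PowerSeries.mul_invOfUnit a 1 ha1
  have hga : g * a = 1 := PowerSeries.invOfUnit_mul a 1 ha1
  set V : Submodule ℂ B := Submodule.span ℂ {1} ⊔ words φ S i False with hV
  have left : ∀ b ∈ centered φ S (i + 1), ∀ y ∈ V, b * y ∈ words φ S (i + 1) True := by
    intro b hb y hy
    obtain ⟨c, hc, z, hz, rfl⟩ := Submodule.mem_sup.1 hy
    obtain ⟨r, rfl⟩ := Submodule.mem_span_singleton.1 hc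
    rw [mul_add, mul_smul_comm, mul_one]
    refine Submodule.add_mem _ (Submodule.smul_mem _ _ (centered_le_words hb)) ?_
    have := mul_mem_words (e := False) hb (by rwa [add_one_add_one])
    simpa using this
  have left' : ∀ b ∈ centered φ S i, ∀ y ∈ words φ S (i + 1) True,
      b * y ∈ words φ S i False := by
    intro b hb y hy
    simpa using mul_mem_words hb hy
  have left'' : ∀ b ∈ centered φ S (i + 1), ∀ y ∈ words φ S i True,
      b * y ∈ words φ S (i + 1) False := by
    intro b hb y hy
    have := mul_mem_words (e := True) hb (by rwa [add_one_add_one])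
    simpa using this
  have right : ∀ y ∈ V, ∀ b ∈ centered φ S i, y * b ∈ words φ S i True := by
    intro y hy b hb
    obtain ⟨c, hc, z, hz, rfl⟩ := Submodule.mem_sup.1 hy
    obtain ⟨r, rfl⟩ := Submodule.mem_span_singleton.1 hc
    rw [add_mul, smul_mul_assoc, one_mul]
    refine Submodule.add_mem _ (Submodule.smul_mem _ _ (centered_le_words hb)) ?_
    have := words_mul_mem hz (j := i) (fun n hn => ?_) hb
    · simpa using this
    · simp only [iff_false] at hn
      simp [alt, Nat.even_add_one, hn]
  have gV : CoeffsIn V g := by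
    intro n
    induction n using Nat.strong_induction_on with
    | _ n ih =>
      -- In this fixed-point equation a coefficient of g depends only on earlier ones, so membership
      -- in `V` follows by strong induction.
      have e : g = 1 + PowerSeries.X * (v₁ * (v₂ * g) - g) := by
        rw [← hag, ha]
        noncomm_ring
      cases n with
      | zero =>
        rw [e]
        have : (1 : B) ∈ V := Submodule.mem_sup_left (Submodule.mem_span_singleton_self 1)
        simpa using this
      | succ n =>
        rw [e]
        have h1 : PowerSeries.coeff (n + 1) (1 : B⟦X⟧) = 0 := by simp [PowerSeries.coeff_one]
        rw [map_add, h1, zero_add, PowerSeries.coeff_succ_X_mul, map_sub]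
        refine Submodule.sub_mem _ ?_ (ih n (by omega))
        rw [PowerSeries.coeff_mul]
        refine Submodule.sum_mem _ fun p hp => Submodule.mem_sup_right (left' _ (h₁ _) _ ?_)
        rw [PowerSeries.coeff_mul]
        refine Submodule.sum_mem _ fun q hq => left _ (h₂ _) _ (ih _ ?_)
        rw [Finset.HasAntidiagonal.mem_antidiagonal] at hp hq
        omega
  refine ⟨g, hag, hga, ?_, gV.mul right h₁, h₂.mul left gV, h₂.mul left'' (gV.mul right h₁)⟩
  rw [mul_assoc]
  exact h₁.mul left' (h₂.mul left gV)

end Series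

/-! ### The product of two infinitesimally free elements -/

section Product

variable {B : Type u} [Ring B] [Algebra ℂ B] {φ φ' : B →ₗ[ℂ] ℂ}

theorem aeval_mem_of_mem {S : Subalgebra ℂ B} {b : B} (hb : b ∈ S)
    (q : Polynomial ℂ) : Polynomial.aeval b q ∈ S :=
  Algebra.adjoin_le (Set.singleton_subset_iff.2 hb) (Polynomial.aeval_mem_adjoin_singleton ℂ b)

theorem coeffsIn_evalSeries {S : Fin 2 → Subalgebra ℂ B} {i : Fin 2} {b : B} (hb : b ∈ S i)
    {v : (Polynomial ℂ)⟦X⟧} (hv : hat (law φ b) v = 0) :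
    CoeffsIn (centered φ S i) (evalSeries b v) := by
  intro n
  rw [coeff_evalSeries, mem_centered]
  refine ⟨aeval_mem_of_mem hb _, ?_⟩
  have := congrArg (PowerSeries.coeff n) hv
  rw [coeff_hat, map_zero] at this
  exact this

theorem mem_generated_zero (b₁ b₂ : B) : b₁ ∈ generated b₁ b₂ 0 :=
  Algebra.subset_adjoin rfl

theorem mem_generated_one (b₁ b₂ : B) : b₂ ∈ generated b₁ b₂ 1 :=
  Algebra.subset_adjoin rfl

/-- The moment series of the product of two infinitesimally free elements, in the variable in
which the resolvents of the factors are centered. -/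
theorem moments_mul_subst {b₁ b₂ : B} (H : InfinitesimallyFree φ φ' (generated b₁ b₂))
    (hφ : φ 1 = 1) (hφ' : φ' 1 = 0) {h₁ h₂ : ℂ⟦X⟧} {v₁ v₂ : (Polynomial ℂ)⟦X⟧}
    (D₁ : IsCenteredResolvent (law φ b₁) h₁ v₁) (D₂ : IsCenteredResolvent (law φ b₂) h₂ v₂) :
    (moments (law φ (b₁ * b₂))).subst
        (PowerSeries.X * h₁ * h₂ * (1 + PowerSeries.X)) = 1 + PowerSeries.X ∧
      ∃ y₁ y₂ : ℂ⟦X⟧, (moments (law φ' (b₁ * b₂))).subst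
          (PowerSeries.X * h₁ * h₂ * (1 + PowerSeries.X)) = PowerSeries.X * (y₁ + y₂) ∧
        (1 + PowerSeries.X) * y₁ = (1 + PowerSeries.X) * hat (law φ' b₁) v₁ +
          PowerSeries.X * hat (law φ b₁) (v₁ * v₁) * y₂ ∧
        (1 + PowerSeries.X) * y₂ = (1 + PowerSeries.X) * hat (law φ' b₂) v₂ +
          PowerSeries.X * hat (law φ b₂) (v₂ * v₂) * y₁ := by
  set w : ℂ⟦X⟧ := PowerSeries.X * h₁ * h₂ * (1 + PowerSeries.X) with hw
  have hw0 : PowerSeries.constantCoeff w = 0 := by simp [hw]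
  set u₁ := evalSeries b₁ v₁ with hu₁
  set u₂ := evalSeries b₂ v₂ with hu₂
  have c₁ : CoeffsIn (centered φ (generated b₁ b₂) 0) u₁ :=
    coeffsIn_evalSeries (mem_generated_zero b₁ b₂) D₁.centered
  have c₂ : CoeffsIn (centered φ (generated b₁ b₂) 1) u₂ :=
    coeffsIn_evalSeries (mem_generated_one b₁ b₂) D₂.centered
  obtain ⟨g, hag, hga, g₁, g₂, g₃, g₄⟩ := exists_geometric c₁ c₂
  -- Scalar series act through `scal`, so the factorization over a general commutative ring applies.
  let _ : Algebra ℂ⟦X⟧ B⟦X⟧ := (scal B).toAlgebra' scal_commute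
  have smul_def : ∀ (s : ℂ⟦X⟧) (f : B⟦X⟧), s • f = scal B s * f := fun _ _ => rfl
  have hX : ∀ f : B⟦X⟧, (PowerSeries.X : ℂ⟦X⟧) • f = PowerSeries.X * f := fun f => by
    rw [smul_def, scal_X]
  have hat_smul : ∀ (ψ : B →ₗ[ℂ] ℂ) (s : ℂ⟦X⟧) (f : B⟦X⟧), hat ψ (s • f) = s * hat ψ f :=
    fun ψ s f => hat_scal_mul ψ s f
  have hat_one : ∀ ψ : B →ₗ[ℂ] ℂ, hat ψ (1 : B⟦X⟧) = PowerSeries.C (ψ 1) := fun ψ => by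
    rw [← map_one (PowerSeries.C (R := B)), hat_C]
  -- the resolvents of the factors
  have res : ∀ (b : B) (h : ℂ⟦X⟧) (v : (Polynomial ℂ)⟦X⟧), IsCenteredResolvent (law φ b) h v →
      h • (PowerSeries.C b * (((1 : ℂ⟦X⟧) + PowerSeries.X) • (1 : B⟦X⟧) +
        (PowerSeries.X : ℂ⟦X⟧) • evalSeries b v)) = 1 + evalSeries b v ∧
      h • ((((1 : ℂ⟦X⟧) + PowerSeries.X) • (1 : B⟦X⟧) +
        (PowerSeries.X : ℂ⟦X⟧) • evalSeries b v) * PowerSeries.C b) = 1 + evalSeries b v := by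
    intro b h v D
    have e := congrArg (evalSeries b) D.resolvent_eq
    have hXb : evalSeries b PowerSeries.X = PowerSeries.X := by simp [evalSeries]
    have e' : scal _ h * ((1 + PowerSeries.X + PowerSeries.X * v) *
        PowerSeries.C Polynomial.X) = 1 + v := by
      rw [← D.resolvent_eq]; ring
    have e' := congrArg (evalSeries b) e'
    simp only [map_mul, map_add, map_one, evalSeries_scal, evalSeries_C, hXb] at e e'
    rw [hX, smul_def, smul_def, smul_def, map_add, map_one, scal_X, mul_one, ← mul_assoc]
    exact ⟨e, e'⟩
  have hM : ∀ f : B⟦X⟧, ((1 : ℂ⟦X⟧) + PowerSeries.X) • f = f + PowerSeries.X * f := fun f => by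
    rw [add_smul, one_smul, hX]
  have hg : (((1 : ℂ⟦X⟧) + PowerSeries.X) • (1 : B⟦X⟧) -
      (PowerSeries.X : ℂ⟦X⟧) • (u₁ * u₂)) * g = 1 := by
    rw [hX, hM, mul_one, hag]
  -- the resolvent of the product
  set R : B⟦X⟧ := evalSeries (b₁ * b₂) (resolvent w) with hR
  have hR1 : R * (1 - w • (PowerSeries.C b₁ * PowerSeries.C b₂)) = 1 := by
    have e := one_sub_dilate_mul_resolvent hw0
    rw [mul_comm] at e
    have e := congrArg (evalSeries (b₁ * b₂)) e
    simp only [map_mul, map_sub, map_one, dilate, evalSeries_scal, evalSeries_C] at e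
    exact e
  have hfac := resolvent_mul_factor (R := ℂ⟦X⟧) (A := B⟦X⟧) rfl rfl (res b₁ h₁ v₁ D₁).1
    (res b₁ h₁ v₁ D₁).2 (res b₂ h₂ v₂ D₂).1 hg
  have hReq := left_inv_eq_right_inv hR1 hfac
  have hexp : R = ((1 : ℂ⟦X⟧) + PowerSeries.X) ^ 2 • g +
      ((1 + PowerSeries.X) * PowerSeries.X : ℂ⟦X⟧) • (g * u₁ + u₂ * g) +
      (PowerSeries.X ^ 2 : ℂ⟦X⟧) • (u₂ * (g * u₁)) := by
    rw [hReq]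
    exact smul_one_add_mul_mul _ _ _ _
  have hg' : ((1 : ℂ⟦X⟧) + PowerSeries.X) • g = 1 + (PowerSeries.X : ℂ⟦X⟧) • (u₁ * u₂ * g) := by
    rw [hM, hX, ← hag]
    noncomm_ring
  -- Expanding g once from the left puts u₁ at both ends, the shape required by `apply_mul_mul`. For
  -- u₂ g the expansion is made from the right.
  have hgu : ((1 : ℂ⟦X⟧) + PowerSeries.X) • (g * u₁) =
      u₁ + (PowerSeries.X : ℂ⟦X⟧) • (u₁ * (u₂ * g) * u₁) := by
    rw [← smul_mul_assoc, hg', add_mul, one_mul, smul_mul_assoc]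
    simp only [mul_assoc]
  have hug : ((1 : ℂ⟦X⟧) + PowerSeries.X) • (u₂ * g) =
      u₂ + (PowerSeries.X : ℂ⟦X⟧) • (u₂ * (g * u₁) * u₂) := by
    have e : ((1 : ℂ⟦X⟧) + PowerSeries.X) • g =
        1 + (PowerSeries.X : ℂ⟦X⟧) • (g * u₁ * u₂) := by
      have : g * (1 + PowerSeries.X) = (1 + PowerSeries.X) * g := by
        have := scal_commute (1 + PowerSeries.X) g
        simpa [scal_X] using this.symm
      have hXg : g * PowerSeries.X = PowerSeries.X * g := (PowerSeries.commute_X g).eq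
      rw [mul_sub, this, ← mul_assoc, hXg] at hga
      rw [hM, hX, ← hga]
      noncomm_ring
    rw [← mul_smul_comm, e, mul_add, mul_one, mul_smul_comm]
    simp only [mul_assoc]
  have M0 : (1 + PowerSeries.X : ℂ⟦X⟧) ≠ 0 := by
    intro h
    simpa using congrArg PowerSeries.constantCoeff h
  have φ_zero : ∀ {i : Fin 2} {e : Prop} {f : B⟦X⟧},
      CoeffsIn (words φ (generated b₁ b₂) i e) f → hat φ f = 0 :=
    fun hf => hf.hat_eq_zero fun b hb => apply_words_eq_zero H hb
  have φ'_zero : ∀ {i : Fin 2} {f : B⟦X⟧},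
      CoeffsIn (words φ (generated b₁ b₂) i False) f → hat φ' f = 0 :=
    fun hf => hf.hat_eq_zero fun b hb => apply_even_words_eq_zero H hb
  have φg : (1 + PowerSeries.X) * hat φ g = 1 := by
    rw [← hat_smul, hg', map_add, hat_smul, φ_zero g₁, hat_one, hφ]
    simp
  have φ'g : hat φ' g = 0 := by
    refine (mul_eq_zero.1 ?_).resolve_left M0
    rw [← hat_smul, hg', map_add, hat_smul, φ'_zero g₁, hat_one, hφ']
    simp
  have hsq : ∀ (b : B) (v : (Polynomial ℂ)⟦X⟧),
      hat φ (evalSeries b v * evalSeries b v) = hat (law φ b) (v * v) := fun b v => by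
    rw [← map_mul, hat_evalSeries]
  -- The words g u₁ and u₂ g occur in R with coefficient (1 + X) X; the factor X is split off.
  refine ⟨?_, (1 + PowerSeries.X) * hat φ' (g * u₁), (1 + PowerSeries.X) * hat φ' (u₂ * g),
    ?_, ?_, ?_⟩
  · rw [← hat_resolvent _ hw0, ← hat_evalSeries, ← hR, hexp]
    rw [map_add, map_add, hat_smul, hat_smul, hat_smul, map_add, φ_zero g₂, φ_zero g₃, φ_zero g₄]
    linear_combination (1 + PowerSeries.X) * φg
  · rw [← hat_resolvent _ hw0, ← hat_evalSeries, ← hR, hexp]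
    rw [map_add, map_add, hat_smul, hat_smul, hat_smul, map_add, φ'_zero g₄, φ'g]
    ring
  · have e := congrArg (hat φ') hgu
    rw [hat_smul, map_add, hat_smul, hat_mul_mul (fun b hb c hc y hy =>
      apply_mul_mul H hb hc hy) c₁ c₁ g₃, hsq, hat_evalSeries] at e
    linear_combination (1 + PowerSeries.X) * e
  · have e := congrArg (hat φ') hug
    rw [hat_smul, map_add, hat_smul, hat_mul_mul (fun b hb c hc y hy =>
      apply_mul_mul (i := 1) H hb hc hy) c₂ c₂ g₂, hsq, hat_evalSeries] at e
    linear_combination (1 + PowerSeries.X) * e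

theorem subst_variable_ne_zero {μ₁ μ₂ : Distribution} {h₁ h₂ : ℂ⟦X⟧} {v₁ v₂ : (Polynomial ℂ)⟦X⟧}
    (D₁ : IsCenteredResolvent μ₁ h₁ v₁) (D₂ : IsCenteredResolvent μ₂ h₂ v₂) :
    PowerSeries.coeff 1 (PowerSeries.X * h₁ * h₂ * (1 + PowerSeries.X)) ≠ 0 := by
  rw [mul_assoc, mul_assoc, show (1 : ℕ) = 0 + 1 from rfl, PowerSeries.coeff_succ_X_mul]
  simpa using ⟨D₁.constantCoeff_ne_zero, D₂.constantCoeff_ne_zero⟩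

theorem law_ext {C : Type v} [Ring C] [Algebra ℂ C] {φ : B →ₗ[ℂ] ℂ} {ψ : C →ₗ[ℂ] ℂ} {b : B}
    {c : C} (h : ∀ n, φ (b ^ n) = ψ (c ^ n)) : law φ b = law ψ c := by
  refine (Polynomial.basisMonomials ℂ).ext fun n => ?_
  simp [law, Polynomial.aeval_monomial, h]

theorem law_X_pow (φ : B →ₗ[ℂ] ℂ) (b : B) (n : ℕ) :
    law φ b (Polynomial.X ^ n) = φ (b ^ n) := by
  simp [law]

theorem law_one (φ : B →ₗ[ℂ] ℂ) (b : B) : law φ b 1 = φ 1 := by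
  simp [law]

/-- The moment series determines a distribution. -/
theorem eq_of_moments_eq {μ ν : Distribution} (h : moments μ = moments ν) : μ = ν := by
  refine (Polynomial.basisMonomials ℂ).ext fun n => ?_
  have := congrArg (PowerSeries.coeff n) h
  simpa [moments, Polynomial.monomial_one_right_eq_X_pow] using this

/-- The product formula, for elements of nonzero mean. -/
theorem isInverseMarkovKrein_mul_of_ne_zero {μ₁ μ₂ τ₁ τ₂ : Distribution} {b₁ b₂ : B}
    (hτ₁ : IsInverseMarkovKrein μ₁ τ₁) (hτ₂ : IsInverseMarkovKrein μ₂ τ₂)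
    (H : InfFreeRealization (μ₁, μ₁ - τ₁) (μ₂, μ₂ - τ₂) φ φ' b₁ b₂)
    (hm₁ : μ₁ Polynomial.X ≠ 0) (hm₂ : μ₂ Polynomial.X ≠ 0) :
    IsInverseMarkovKrein (law φ (b₁ * b₂)) (law φ (b₁ * b₂) - law φ' (b₁ * b₂)) := by
  obtain ⟨hφ, hφ', hl₁, hl₂, H⟩ := H
  obtain ⟨rfl, hl₁⟩ := Prod.mk.inj hl₁
  obtain ⟨rfl, hl₂⟩ := Prod.mk.inj hl₂
  obtain ⟨h₁, v₁, D₁, d₁, q₁⟩ := exists_isCenteredResolvent (by rw [law_one, hφ]) hm₁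
  obtain ⟨h₂, v₂, D₂, d₂, q₂⟩ := exists_isCenteredResolvent (by rw [law_one, hφ]) hm₂
  obtain ⟨e, y₁, y₂, e', f₁, f₂⟩ := moments_mul_subst H hφ hφ' D₁ D₂
  have q₁ := q₁ τ₁ hτ₁
  have q₂ := q₂ τ₂ hτ₂
  rw [← hl₁] at q₁
  rw [← hl₂] at q₂
  set a := PowerSeries.X * hat (law φ b₁) (v₁ * v₁) with ha
  set b := PowerSeries.X * hat (law φ b₂) (v₂ * v₂) with hb
  rw [q₁] at f₁
  rw [q₂] at f₂
  set w : ℂ⟦X⟧ := PowerSeries.X * h₁ * h₂ * (1 + PowerSeries.X) with hw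
  have hw0 : PowerSeries.constantCoeff w = 0 := by simp [hw]
  have hs := PowerSeries.HasSubst.of_constantCoeff_zero' hw0
  have hX : (PowerSeries.X : ℂ⟦X⟧) ≠ 0 := PowerSeries.X_ne_zero
  have hh₁ : h₁ ≠ 0 := fun h => D₁.constantCoeff_ne_zero (by simp [h])
  have hh₂ : h₂ ≠ 0 := fun h => D₂.constantCoeff_ne_zero (by simp [h])
  have hH₁ : 1 + PowerSeries.X + a ≠ 0 := fun h => hh₁ (by rw [← d₁, h, zero_mul])
  have hH₂ : 1 + PowerSeries.X + b ≠ 0 := fun h => hh₂ (by rw [← d₂, h, zero_mul])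
  set w' := PowerSeries.derivative ℂ w with hw'
  have hXw : w + PowerSeries.X * w' =
      PowerSeries.derivative ℂ (PowerSeries.X * h₁) * (PowerSeries.X * h₂) * (1 + PowerSeries.X) +
      PowerSeries.derivative ℂ (PowerSeries.X * h₂) * (PowerSeries.X * h₁) * (1 + PowerSeries.X) +
      (PowerSeries.X * h₁) * (PowerSeries.X * h₂) := by
    have e1 : PowerSeries.X * w =
        (PowerSeries.X * h₁) * (PowerSeries.X * h₂) * (1 + PowerSeries.X) := by
      rw [hw]; ring
    have := congrArg (PowerSeries.derivative ℂ) e1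
    simp only [Derivation.leibniz _ PowerSeries.X w,
      Derivation.leibniz _ (_ * _ : ℂ⟦X⟧) (1 + PowerSeries.X),
      Derivation.leibniz _ (PowerSeries.X * h₁) (PowerSeries.X * h₂),
      map_add, PowerSeries.derivative_X, Derivation.map_one_eq_zero, smul_eq_mul] at this
    rw [← hw'] at this
    linear_combination this
  -- The linear system gives 1 - y₁ - y₂ as (1 + X + a)(1 + X + b) over (1 + X)² - a b (`g3`).
  -- Differentiating X w and eliminating the derivatives of X hᵢ gives w' as h₁ h₂ times the inverse
  -- of this quotient (`g2`).
  have hw'1 : (1 - y₁ - y₂) * w' = h₁ * h₂ := by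
    have g1 : w' = (1 + PowerSeries.X) * (PowerSeries.derivative ℂ (PowerSeries.X * h₁) * h₂ +
        PowerSeries.derivative ℂ (PowerSeries.X * h₂) * h₁) - h₁ * h₂ := by
      apply mul_left_cancel₀ hX
      linear_combination hXw - hw
    have g2 : (1 + PowerSeries.X + a) * (1 + PowerSeries.X + b) * w' =
        h₁ * h₂ * ((1 + PowerSeries.X) ^ 2 - a * b) := by
      rw [g1]
      linear_combination (1 + PowerSeries.X) * (1 + PowerSeries.X + b) * h₂ * d₁ +
        (1 + PowerSeries.X) * (1 + PowerSeries.X + a) * h₁ * d₂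
    have g3 : (1 - y₁ - y₂) * ((1 + PowerSeries.X) ^ 2 - a * b) =
        (1 + PowerSeries.X + a) * (1 + PowerSeries.X + b) := by
      linear_combination (-(1 + PowerSeries.X + b)) * f₁ - (1 + PowerSeries.X + a) * f₂
    apply mul_left_cancel₀ (mul_ne_zero hH₁ hH₂)
    linear_combination (1 - y₁ - y₂) * g2 + h₁ * h₂ * g3
  have hw'0 : w' ≠ 0 := by
    intro h
    rw [h, mul_zero] at hw'1
    exact mul_ne_zero hh₁ hh₂ hw'1.symm
  rw [isInverseMarkovKrein_iff]
  -- After substitution of w the claim reads (1 + X - X (y₁ + y₂)) (1 + X) = 1 + X + w / w'.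
  apply subst_injective hw0 (subst_variable_ne_zero D₁ D₂)
  have hmom : moments (law φ (b₁ * b₂) - law φ' (b₁ * b₂)) =
      moments (law φ (b₁ * b₂)) - moments (law φ' (b₁ * b₂)) := by
    ext n; simp [moments]
  have hder : (PowerSeries.derivative ℂ (moments (law φ (b₁ * b₂)))).subst w * w' = 1 := by
    rw [hw', ← PowerSeries.derivative_subst hs, e]
    simp
  simp only [PowerSeries.subst_mul hs, hmom, PowerSeries.subst_sub hs, e, e', Derivation.leibniz,
    PowerSeries.derivative_X, smul_eq_mul, mul_one, PowerSeries.subst_add hs,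
    PowerSeries.subst_X hs]
  apply mul_right_cancel₀ hw'0
  linear_combination PowerSeries.X * (1 + PowerSeries.X) * hw'1 - w * hder - hw

end Product

/-! ### Translation by scalars and removal of the condition on the means -/

section Translation

variable {B : Type u} [Ring B] [Algebra ℂ B]

/-- The distribution of `x + s`, when `x` has distribution `μ`. -/
noncomputable def translate (s : ℂ) (μ : Distribution) : Distribution :=
  law μ (Polynomial.X + Polynomial.C s)

theorem translate_sub (s : ℂ) (μ ν : Distribution) :
    translate s (μ - ν) = translate s μ - translate s ν := rfl

theorem translate_one (s : ℂ) (μ : Distribution) : translate s μ 1 = μ 1 :=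
  law_one _ _

theorem law_add_algebraMap (φ : B →ₗ[ℂ] ℂ) (b : B) (s : ℂ) :
    law φ (b + algebraMap ℂ B s) = translate s (law φ b) := by
  refine law_ext fun n => ?_
  simp [law]

theorem translate_apply_X (s : ℂ) {μ : Distribution} (hμ : μ 1 = 1) :
    translate s μ Polynomial.X = μ Polynomial.X + s := by
  have h : (Polynomial.C s : Polynomial ℂ) = s • 1 := by simp [Polynomial.smul_eq_C_mul]
  simp [translate, law, h, hμ]

/-- The reason is 1 - X (x + s) = (1 - s X) (1 - X c x), where c inverts 1 - s X. -/
theorem moments_translate (s : ℂ) (μ : Distribution) {c : ℂ⟦X⟧}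
    (hc : c * (1 - PowerSeries.C s * PowerSeries.X) = 1) :
    moments (translate s μ) = c * (moments μ).subst (PowerSeries.X * c) := by
  have hβ : PowerSeries.constantCoeff (PowerSeries.X * c) = 0 := by simp
  have hX0 : PowerSeries.constantCoeff (PowerSeries.X : ℂ⟦X⟧) = 0 := by simp
  set R := evalSeries (Polynomial.X + Polynomial.C s) (resolvent PowerSeries.X) with hR
  have h1 : moments (translate s μ) = hat μ R := by
    rw [hR, hat_evalSeries, hat_resolvent _ hX0, PowerSeries.X_subst]
    rfl
  have h2 : (1 - dilate PowerSeries.X - scal _ (PowerSeries.C s) * PowerSeries.X) * R = 1 := by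
    have e := congrArg (evalSeries (Polynomial.X + Polynomial.C s : Polynomial ℂ))
      (one_sub_dilate_mul_resolvent hX0)
    have hs : scal (Polynomial ℂ) (PowerSeries.C s) = PowerSeries.C (Polynomial.C s) := by
      simp [scal]
    have hX : evalSeries (Polynomial.X + Polynomial.C s : Polynomial ℂ) PowerSeries.X =
        PowerSeries.X := by simp [evalSeries]
    simp only [dilate, map_mul, map_sub, map_one, evalSeries_C, map_add, scal_X, hX] at e ⊢
    rw [hs]
    linear_combination e
  have h3 : (1 - dilate PowerSeries.X - scal _ (PowerSeries.C s) * PowerSeries.X) *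
      (scal _ c * resolvent (PowerSeries.X * c)) = 1 := by
    have e := one_sub_dilate_mul_resolvent hβ
    have e' := congrArg (scal (Polynomial ℂ)) hc
    simp only [dilate, map_mul, map_sub, map_one, scal_X] at e e' ⊢
    linear_combination e + resolvent (PowerSeries.X * c) * e'
  have h4 : R = scal _ c * resolvent (PowerSeries.X * c) :=
    left_inv_eq_right_inv (by rw [mul_comm]; exact h2) h3
  rw [h1, h4, hat_scal_mul, hat_resolvent _ hβ]

/-- The series X M changes by the substitution X c alone. The derivative of X c is c², one factor c
for each moment series on the left side. -/
theorem IsInverseMarkovKrein.translate {μ τ : Distribution} (h : IsInverseMarkovKrein μ τ)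
    (s : ℂ) : IsInverseMarkovKrein (translate s μ) (translate s τ) := by
  have hunit : PowerSeries.constantCoeff (1 - PowerSeries.C s * PowerSeries.X : ℂ⟦X⟧) ≠ 0 := by
    simp
  obtain ⟨c, hc⟩ : ∃ c : ℂ⟦X⟧, c * (1 - PowerSeries.C s * PowerSeries.X) = 1 :=
    ⟨_, PowerSeries.inv_mul_cancel _ hunit⟩
  have hs : PowerSeries.HasSubst (PowerSeries.X * c) :=
    PowerSeries.HasSubst.of_constantCoeff_zero' (by simp)
  have hder : PowerSeries.derivative ℂ (PowerSeries.X * c) = c * c := by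
    have e := congrArg (PowerSeries.derivative ℂ) hc
    simp only [Derivation.leibniz, map_sub, PowerSeries.derivative_X, Derivation.map_one_eq_zero,
      PowerSeries.derivative_C, smul_eq_mul] at e ⊢
    linear_combination (PowerSeries.X * c) * e +
      (- c - PowerSeries.X * PowerSeries.derivative ℂ c) * hc
  rw [isInverseMarkovKrein_iff] at h ⊢
  have e := congrArg (PowerSeries.subst (PowerSeries.X * c)) h
  rw [PowerSeries.subst_mul hs] at e
  have e2 : PowerSeries.X * moments (InfFree.translate s μ) =
      (PowerSeries.X * moments μ).subst (PowerSeries.X * c) := by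
    rw [moments_translate s μ hc, PowerSeries.subst_mul hs, PowerSeries.subst_X hs, mul_assoc]
  rw [e2, PowerSeries.derivative_subst hs, hder, ← e, moments_translate s μ hc,
    moments_translate s τ hc]
  ring

theorem adjoin_add_algebraMap (b : B) (s : ℂ) :
    Algebra.adjoin ℂ {b + algebraMap ℂ B s} = Algebra.adjoin ℂ {b} := by
  apply le_antisymm <;> refine Algebra.adjoin_le (Set.singleton_subset_iff.2 ?_)
  · exact Subalgebra.add_mem _ (Algebra.subset_adjoin rfl) (Subalgebra.algebraMap_mem _ s)
  · have := Subalgebra.sub_mem _ (Algebra.subset_adjoin (R := ℂ)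
      (Set.mem_singleton (b + algebraMap ℂ B s))) (Subalgebra.algebraMap_mem _ s)
    simpa using this

theorem InfFreeRealization.translate {μ₁ μ₁' μ₂ μ₂' : Distribution} {φ φ' : B →ₗ[ℂ] ℂ} {b₁ b₂ : B}
    (H : InfFreeRealization (μ₁, μ₁') (μ₂, μ₂') φ φ' b₁ b₂) (s : ℂ) :
    InfFreeRealization (translate s μ₁, translate s μ₁') (translate s μ₂, translate s μ₂') φ φ'
      (b₁ + algebraMap ℂ B s) (b₂ + algebraMap ℂ B s) := by
  obtain ⟨hφ, hφ', hl₁, hl₂, H⟩ := H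
  obtain ⟨rfl, rfl⟩ := Prod.mk.inj hl₁
  obtain ⟨rfl, rfl⟩ := Prod.mk.inj hl₂
  refine ⟨hφ, hφ', by simp only [law_add_algebraMap], by simp only [law_add_algebraMap], ?_⟩
  rwa [generated, adjoin_add_algebraMap, adjoin_add_algebraMap]

/-- The moments of a product of translated elements depend continuously on the translation. -/
theorem continuous_apply_translate_pow (φ : B →ₗ[ℂ] ℂ) (b₁ b₂ : B) (n : ℕ) :
    Continuous fun s : ℂ => φ (((b₁ + algebraMap ℂ B s) * (b₂ + algebraMap ℂ B s)) ^ n) := by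
  -- The induction treats all functionals at once, because left multiplication by `b` is absorbed
  -- into ψ.
  have step : ∀ (b : B) (f : ℂ → B), (∀ ψ : B →ₗ[ℂ] ℂ, Continuous fun s => ψ (f s)) →
      ∀ ψ : B →ₗ[ℂ] ℂ, Continuous fun s => ψ ((b + algebraMap ℂ B s) * f s) := by
    intro b f hf ψ
    have e : ∀ s, ψ ((b + algebraMap ℂ B s) * f s) =
        (ψ ∘ₗ LinearMap.mulLeft ℂ b) (f s) + s * ψ (f s) := fun s => by
      rw [add_mul, map_add, ← Algebra.smul_def, map_smul, smul_eq_mul]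
      rfl
    simp only [e]
    exact (hf _).add (continuous_id.mul (hf ψ))
  have key : ∀ ψ : B →ₗ[ℂ] ℂ, Continuous fun s : ℂ =>
      ψ (((b₁ + algebraMap ℂ B s) * (b₂ + algebraMap ℂ B s)) ^ n) := by
    induction n with
    | zero => intro ψ; simpa using continuous_const
    | succ n ih =>
      simp only [pow_succ', mul_assoc]
      exact step b₁ _ (step b₂ _ ih)
  exact key φ

/-- Two continuous functions agreeing outside two points are equal. -/
theorem eq_of_eq_off_pair {f g : ℂ → ℂ} (hf : Continuous f) (hg : Continuous g) (a b : ℂ)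
    (h : ∀ s, a + s ≠ 0 → b + s ≠ 0 → f s = g s) : f 0 = g 0 := by
  have hd : Dense ({-a, -b} : Set ℂ)ᶜ := (Set.toFinite _).countable.dense_compl ℝ
  refine congrFun (Continuous.ext_on hd hf hg fun s hs => ?_) 0
  simp only [Set.mem_compl_iff, Set.mem_insert_iff, Set.mem_singleton_iff, not_or] at hs
  exact h s (fun e => hs.1 (by linear_combination e)) fun e => hs.2 (by linear_combination e)

/-- For the translated elements each coefficient identity is continuous in s and holds unless s is
the negative of one of the two means; it therefore holds at s = 0. -/
theorem isInverseMarkovKrein_mul {μ₁ μ₂ τ₁ τ₂ : Distribution} {φ φ' : B →ₗ[ℂ] ℂ} {b₁ b₂ : B}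
    (hμ₁ : μ₁ 1 = 1) (hμ₂ : μ₂ 1 = 1)
    (hτ₁ : IsInverseMarkovKrein μ₁ τ₁) (hτ₂ : IsInverseMarkovKrein μ₂ τ₂)
    (H : InfFreeRealization (μ₁, μ₁ - τ₁) (μ₂, μ₂ - τ₂) φ φ' b₁ b₂) :
    IsInverseMarkovKrein (law φ (b₁ * b₂)) (law φ (b₁ * b₂) - law φ' (b₁ * b₂)) := by
  rw [isInverseMarkovKrein_iff_sum]
  intro n
  have hc := continuous_apply_translate_pow φ b₁ b₂
  have hc' := continuous_apply_translate_pow φ' b₁ b₂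
  have := eq_of_eq_off_pair
    (f := fun s => ∑ p ∈ Finset.HasAntidiagonal.antidiagonal n,
      (φ (((b₁ + algebraMap ℂ B s) * (b₂ + algebraMap ℂ B s)) ^ p.1) -
        φ' (((b₁ + algebraMap ℂ B s) * (b₂ + algebraMap ℂ B s)) ^ p.1)) *
        φ (((b₁ + algebraMap ℂ B s) * (b₂ + algebraMap ℂ B s)) ^ p.2))
    (g := fun s => ((n : ℂ) + 1) *
      φ (((b₁ + algebraMap ℂ B s) * (b₂ + algebraMap ℂ B s)) ^ n))
    (continuous_finsetSum _ fun p _ => ((hc _).sub (hc' _)).mul (hc _))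
    (continuous_const.mul (hc n)) (μ₁ Polynomial.X) (μ₂ Polynomial.X) ?_
  · simpa [law_X_pow] using this
  · intro s h₁ h₂
    have Hs := H.translate s
    rw [translate_sub, translate_sub] at Hs
    have := isInverseMarkovKrein_mul_of_ne_zero (hτ₁.translate s) (hτ₂.translate s) Hs
      (by rwa [translate_apply_X s hμ₁]) (by rwa [translate_apply_X s hμ₂])
    simpa [law_X_pow] using (isInverseMarkovKrein_iff_sum _ _).1 this n

/-- With φ' = 0, results on infinitesimal freeness apply to plain freeness. -/
theorem FreeRealization.infFreeRealization {μ₁ μ₂ : Distribution} {φ : B →ₗ[ℂ] ℂ} {a₁ a₂ : B}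
    (H : FreeRealization μ₁ μ₂ φ a₁ a₂) :
    InfFreeRealization (μ₁, 0) (μ₂, 0) φ 0 a₁ a₂ := by
  refine ⟨H.unital, by simp, ?_, ?_, fun n i b hi hb hφ =>
    ⟨H.free n i b hi hb hφ, by simp, by simp⟩⟩
  · rw [H.law_fst]; rfl
  · rw [H.law_snd]; rfl

theorem InfFreeRealization.freeRealization {μ₁ μ₁' μ₂ μ₂' : Distribution} {φ φ' : B →ₗ[ℂ] ℂ}
    {b₁ b₂ : B} (H : InfFreeRealization (μ₁, μ₁') (μ₂, μ₂') φ φ' b₁ b₂) :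
    FreeRealization μ₁ μ₂ φ b₁ b₂ :=
  ⟨H.unital, (Prod.mk.inj H.law_fst).1, (Prod.mk.inj H.law_snd).1,
    fun n i b hi hb hφ => (H.free n i b hi hb hφ).1⟩

/-- The distribution of a product of free elements depends only on the two distributions. -/
theorem law_mul_eq {C : Type v} [Ring C] [Algebra ℂ C] {μ₁ μ₂ : Distribution}
    {φ : B →ₗ[ℂ] ℂ} {a₁ a₂ : B} {ψ : C →ₗ[ℂ] ℂ} {c₁ c₂ : C} (hμ₁ : μ₁ 1 = 1) (hμ₂ : μ₂ 1 = 1)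
    (H : FreeRealization μ₁ μ₂ φ a₁ a₂) (K : FreeRealization μ₁ μ₂ ψ c₁ c₂) :
    law φ (a₁ * a₂) = law ψ (c₁ * c₂) := by
  refine law_ext fun n => ?_
  have := eq_of_eq_off_pair (continuous_apply_translate_pow φ a₁ a₂ n)
    (continuous_apply_translate_pow ψ c₁ c₂ n) (μ₁ Polynomial.X) (μ₂ Polynomial.X) ?_
  · simpa using this
  · intro s h₁ h₂
    have Hs := H.infFreeRealization.translate s
    have Ks := K.infFreeRealization.translate s
    obtain ⟨f₁, v₁, D₁, -⟩ := exists_isCenteredResolvent (μ := translate s μ₁)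
      (by rw [translate_one, hμ₁]) (by rwa [translate_apply_X s hμ₁])
    obtain ⟨f₂, v₂, D₂, -⟩ := exists_isCenteredResolvent (μ := translate s μ₂)
      (by rw [translate_one, hμ₂]) (by rwa [translate_apply_X s hμ₂])
    have e := (moments_mul_subst Hs.free Hs.unital Hs.unital'
      (by rw [(Prod.mk.inj Hs.law_fst).1]; exact D₁)
      (by rw [(Prod.mk.inj Hs.law_snd).1]; exact D₂)).1
    have e' := (moments_mul_subst Ks.free Ks.unital Ks.unital'
      (by rw [(Prod.mk.inj Ks.law_fst).1]; exact D₁)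
      (by rw [(Prod.mk.inj Ks.law_snd).1]; exact D₂)).1
    -- Both moment series become 1 + X under the same substitution, which is built from the two
    -- given distributions alone.
    have := subst_injective (by simp) (subst_variable_ne_zero D₁ D₂) (e.trans e'.symm)
    rw [← law_X_pow φ, ← law_X_pow ψ, eq_of_moments_eq this]

end Translation

/-! ### Existence: multiplication operators on a space of words -/

section Fock

/-- A letter `(i, n)` stands for the centered power `xⁿ⁺¹ - μ i (xⁿ⁺¹)` of the variable with
index `i`. -/
abbrev Letter : Type u := Fin 2 × ULift.{u} ℕ

/-- The vector space spanned by the words in the letters. -/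
abbrev FockSpace : Type u := List Letter.{u} →₀ ℂ

/-- The basis vector of a word. -/
noncomputable def ket (w : List Letter.{u}) : FockSpace.{u} := Finsupp.single w 1

/-- The word `w` does not start with a letter of index `i`. -/
def NotHead (i : Fin 2) (w : List Letter.{u}) : Prop := ∀ x ∈ w.head?, x.1 ≠ i

variable (μ μ' : Fin 2 → Distribution)

/-- Left multiplication of a word by the variable with index `i`. -/
noncomputable def act (i : Fin 2) : List Letter.{u} → FockSpace.{u}
  | [] => ket [(i, ⟨0⟩)] + μ i Polynomial.X • ket []
  | (j, n) :: w =>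
    -- With mₖ the moments, x (xⁿ⁺¹ - mₙ₊₁) = (xⁿ⁺² - mₙ₊₂) - mₙ₊₁ (x - m₁) + (mₙ₊₂ - mₙ₊₁ m₁).
    if j = i then
      ket ((i, ⟨n.down + 1⟩) :: w) - μ i (Polynomial.X ^ (n.down + 1)) • ket ((i, ⟨0⟩) :: w) +
        (μ i (Polynomial.X ^ (n.down + 2)) -
          μ i (Polynomial.X ^ (n.down + 1)) * μ i Polynomial.X) • ket w
    else ket ((i, ⟨0⟩) :: (j, n) :: w) + μ i Polynomial.X • ket ((j, n) :: w)

/-- The operator of left multiplication by the variable with index `i`. -/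
noncomputable def mulOp (i : Fin 2) : Module.End ℂ FockSpace.{u} :=
  Finsupp.linearCombination ℂ (act μ i)

theorem mulOp_ket (i : Fin 2) (w : List Letter.{u}) : mulOp μ i (ket w) = act μ i w := by
  simp [mulOp, ket]

theorem act_of_notHead {i : Fin 2} {w : List Letter.{u}} (h : NotHead i w) :
    act μ i w = ket ((i, ⟨0⟩) :: w) + μ i Polynomial.X • ket w := by
  cases w with
  | nil => rfl
  | cons x w =>
    obtain ⟨j, n⟩ := x
    have : j ≠ i := h (j, n) (by simp)
    rw [act, if_neg this]

/-- The vectors `c ⊗ w` for the centered parts `c` of the powers of the variable with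
index `i`. -/
noncomputable def consPow (i : Fin 2) (w : List Letter.{u}) : ℕ → FockSpace.{u}
  | 0 => 0
  | n + 1 => ket ((i, ⟨n⟩) :: w)

/-- The vector `c ⊗ w` for the centered part `c` of a polynomial in the variable with index
`i`. -/
noncomputable def consPoly (i : Fin 2) (w : List Letter.{u}) : Polynomial ℂ →ₗ[ℂ] FockSpace.{u} :=
  (Polynomial.basisMonomials ℂ).constr ℂ (consPow i w)

theorem consPoly_one (i : Fin 2) (w : List Letter.{u}) : consPoly i w 1 = 0 := by
  have := (Polynomial.basisMonomials ℂ).constr_basis ℂ (consPow i w) 0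
  simpa [consPoly, consPow] using this

theorem consPoly_X_pow (i : Fin 2) (w : List Letter.{u}) (n : ℕ) :
    consPoly i w (Polynomial.X ^ (n + 1)) = ket ((i, ⟨n⟩) :: w) := by
  have := (Polynomial.basisMonomials ℂ).constr_basis ℂ (consPow i w) (n + 1)
  simpa [consPoly, consPow, Polynomial.monomial_one_right_eq_X_pow] using this

/-- Linear maps on polynomials agree if they agree on the powers of the variable. -/
theorem polynomial_lhom_ext {M : Type v} [AddCommMonoid M] [Module ℂ M]
    {F G : Polynomial ℂ →ₗ[ℂ] M} (h0 : F 1 = G 1)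
    (h : ∀ n, F (Polynomial.X ^ (n + 1)) = G (Polynomial.X ^ (n + 1))) : F = G := by
  refine (Polynomial.basisMonomials ℂ).ext fun n => ?_
  cases n with
  | zero => simpa using h0
  | succ n => simpa [Polynomial.monomial_one_right_eq_X_pow] using h n

variable {μ μ'}

/-- A polynomial splits into its mean and its centered part. If the mean vanishes, only words with a
new first letter remain, which is the source of freeness. -/
theorem aeval_mulOp_ket (hμ : ∀ i, μ i 1 = 1) {i : Fin 2} {w : List Letter.{u}}
    (h : NotHead i w) (q : Polynomial ℂ) :
    Polynomial.aeval (mulOp μ i) q (ket w) = μ i q • ket w + consPoly i w q := by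
  have hX : ∀ n, (mulOp μ i ^ (n + 1)) (ket w) =
      μ i (Polynomial.X ^ (n + 1)) • ket w + ket ((i, ⟨n⟩) :: w) := by
    intro n
    induction n with
    | zero => rw [zero_add, pow_one, pow_one, mulOp_ket, act_of_notHead μ h, add_comm]
    | succ n ih =>
      rw [pow_succ', Module.End.mul_apply, ih, map_add, map_smul, mulOp_ket, mulOp_ket,
        act_of_notHead μ h, act, if_pos rfl]
      module
  have : LinearMap.applyₗ (ket w) ∘ₗ (Polynomial.aeval (mulOp μ i)).toLinearMap =
      (μ i).smulRight (ket w) + consPoly i w := by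
    refine polynomial_lhom_ext ?_ fun n => ?_
    · simp [hμ, consPoly_one]
    · simp [consPoly_X_pow, hX]
  exact LinearMap.congr_fun this q

/-- The functional on operators given by a functional applied to the image of the empty word. -/
noncomputable def vacuumState (l : FockSpace.{u} →ₗ[ℂ] ℂ) :
    Module.End ℂ FockSpace.{u} →ₗ[ℂ] ℂ :=
  l ∘ₗ LinearMap.applyₗ (ket [])

theorem vacuumState_apply (l : FockSpace.{u} →ₗ[ℂ] ℂ) (T : Module.End ℂ FockSpace.{u}) :
    vacuumState l T = l (T (ket [])) := rfl

/-- The coefficient of the empty word. -/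
noncomputable def vacuum : FockSpace.{u} →ₗ[ℂ] ℂ := Finsupp.lapply []

variable (μ μ')

/-- The covariance of two letters. -/
noncomputable def covariance (x y : Letter.{u}) : ℂ :=
  μ x.1 (Polynomial.X ^ (x.2.down + 1) * Polynomial.X ^ (y.2.down + 1)) -
    μ x.1 (Polynomial.X ^ (x.2.down + 1)) * μ y.1 (Polynomial.X ^ (y.2.down + 1))

/-- The value of the infinitesimal functional at a word. -/
noncomputable def infWeight (w : List Letter.{u}) : ℂ :=
  if Odd w.length then pairing (covariance μ) (fun x => μ' x.1 (Polynomial.X ^ (x.2.down + 1)))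
    (w.length - 1) fun k => w.getD k default else 0

/-- The infinitesimal functional on the Fock space. -/
noncomputable def infFunctional : FockSpace.{u} →ₗ[ℂ] ℂ :=
  Finsupp.linearCombination ℂ (infWeight μ μ')

variable {μ μ'}

theorem infFunctional_ket (w : List Letter.{u}) :
    infFunctional μ μ' (ket w) = infWeight μ μ' w := by
  simp [infFunctional, ket]

theorem infWeight_singleton (x : Letter.{u}) :
    infWeight μ μ' [x] = μ' x.1 (Polynomial.X ^ (x.2.down + 1)) := by
  simp [infWeight, pairing]

theorem infWeight_cons_append (x y : Letter.{u}) {v : List Letter.{u}} (hv : Odd v.length) :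
    infWeight μ μ' (x :: (v ++ [y])) = covariance μ x y * infWeight μ μ' v := by
  obtain ⟨k, hk⟩ := hv
  have h1 : (x :: (v ++ [y])).length = 2 * k + 1 + 2 := by simp [hk]
  rw [infWeight, infWeight, h1, hk, if_pos (by simp [Nat.odd_add]), if_pos (by simp),
    show 2 * k + 1 + 2 - 1 = (2 * k + 1 - 1) + 2 by omega, pairing_add_two]
  congr 1
  · congr 1
    rw [show 2 * k + 1 - 1 + 2 = (2 * k + 1) + 1 by omega, List.getD_cons_succ, ← hk]
    simp [List.getD]
  · refine pairing_congr _ _ fun j hj => ?_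
    rw [List.getD_cons_succ, List.getD_append _ _ _ _ (by omega)]

theorem law_vacuum (hμ : ∀ i, μ i 1 = 1) (i : Fin 2) :
    law (vacuumState vacuum.{u}) (mulOp μ i) = μ i := by
  have hn : NotHead i ([] : List Letter.{u}) := by simp [NotHead]
  refine polynomial_lhom_ext ?_ fun n => ?_
  · simp [law, vacuumState, vacuum, ket, hμ]
  · change vacuum (Polynomial.aeval (mulOp μ i) _ (ket [])) = _
    rw [aeval_mulOp_ket hμ hn, consPoly_X_pow]
    simp [vacuum, ket]

theorem law_infFunctional (hμ : ∀ i, μ i 1 = 1) (hμ' : ∀ i, μ' i 1 = 0) (i : Fin 2) :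
    law (vacuumState (infFunctional.{u} μ μ')) (mulOp μ i) = μ' i := by
  have hn : NotHead i ([] : List Letter.{u}) := by simp [NotHead]
  have h0 : infWeight μ μ' ([] : List Letter.{u}) = 0 := by simp [infWeight]
  refine polynomial_lhom_ext ?_ fun n => ?_
  · simp [law, vacuumState, infFunctional_ket, h0, hμ']
  · change infFunctional μ μ' (Polynomial.aeval (mulOp μ i) _ (ket [])) = _
    rw [aeval_mulOp_ket hμ hn, consPoly_X_pow, map_add, map_smul, infFunctional_ket,
      infFunctional_ket, h0, infWeight_singleton, smul_zero, zero_add]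

/-- The span of the words of length `n + 1` starting with a letter of index `i`. -/
noncomputable def startSpan (i : Fin 2) (n : ℕ) : Submodule ℂ FockSpace.{u} :=
  Submodule.span ℂ {f | ∃ (k : ULift.{u} ℕ) (w : List Letter.{u}),
    w.length = n ∧ f = ket ((i, k) :: w)}

/-- Right concatenation with a word. -/
noncomputable def appendWord (w : List Letter.{u}) : FockSpace.{u} →ₗ[ℂ] FockSpace.{u} :=
  Finsupp.lmapDomain ℂ ℂ fun v => v ++ w

theorem appendWord_ket (v w : List Letter.{u}) : appendWord w (ket v) = ket (v ++ w) := by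
  simp [appendWord, ket]

theorem appendWord_consPoly (i : Fin 2) (v w : List Letter.{u}) (q : Polynomial ℂ) :
    appendWord w (consPoly i v q) = consPoly i (v ++ w) q := by
  have : appendWord w ∘ₗ consPoly i v = consPoly i (v ++ w) := by
    refine polynomial_lhom_ext ?_ fun n => ?_
    · simp [consPoly_one]
    · simp [consPoly_X_pow, appendWord_ket]
  exact LinearMap.congr_fun this q

theorem consPoly_mem (i : Fin 2) (w : List Letter.{u}) (q : Polynomial ℂ) :
    consPoly i w q ∈ startSpan i w.length := by
  have : (startSpan i w.length).mkQ ∘ₗ consPoly i w = 0 := by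
    refine polynomial_lhom_ext ?_ fun n => ?_
    · simp [consPoly_one]
    · rw [LinearMap.comp_apply, consPoly_X_pow, LinearMap.zero_apply, Submodule.mkQ_apply,
        Submodule.Quotient.mk_eq_zero]
      exact Submodule.subset_span ⟨_, w, rfl, rfl⟩
  have := LinearMap.congr_fun this q
  rwa [LinearMap.comp_apply, LinearMap.zero_apply, Submodule.mkQ_apply,
    Submodule.Quotient.mk_eq_zero] at this

/-- A centered q only prepends letters to such words, so it commutes with concatenation on the
right. -/
theorem centered_apply_startSpan (hμ : ∀ i, μ i 1 = 1) {i : Fin 2} {q : Polynomial ℂ}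
    (hq : μ i q = 0) {n : ℕ} {y : FockSpace.{u}} (hy : y ∈ startSpan (i + 1) n) :
    Polynomial.aeval (mulOp μ i) q y ∈ startSpan i (n + 1) ∧
      ∀ w, Polynomial.aeval (mulOp μ i) q (appendWord w y) =
        appendWord w (Polynomial.aeval (mulOp μ i) q y) := by
  have hn : ∀ k (w : List Letter.{u}), NotHead i ((i + 1, k) :: w) := fun k w => by
    simp [NotHead]
  refine Submodule.span_induction (p := fun y _ =>
    Polynomial.aeval (mulOp μ i) q y ∈ startSpan i (n + 1) ∧
      ∀ w, Polynomial.aeval (mulOp μ i) q (appendWord w y) =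
        appendWord w (Polynomial.aeval (mulOp μ i) q y)) ?_ (by simp) ?_ ?_ hy
  · rintro _ ⟨k, v, rfl, rfl⟩
    refine ⟨?_, fun w => ?_⟩
    · rw [aeval_mulOp_ket hμ (hn _ _), hq, zero_smul, zero_add]
      have := consPoly_mem i ((i + 1, k) :: v) q
      rwa [List.length_cons] at this
    · rw [appendWord_ket, List.cons_append, aeval_mulOp_ket hμ (hn _ _),
        aeval_mulOp_ket hμ (hn _ _), hq, zero_smul, zero_add, zero_smul, zero_add,
        appendWord_consPoly, List.cons_append]
  · rintro x y _ _ ⟨hx, hx'⟩ ⟨hy, hy'⟩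
    refine ⟨by rw [map_add]; exact Submodule.add_mem _ hx hy, fun w => ?_⟩
    simp only [map_add, hx', hy']
  · rintro c x _ ⟨hx, hx'⟩
    refine ⟨by rw [map_smul]; exact Submodule.smul_mem _ c hx, fun w => ?_⟩
    simp only [map_smul, hx']

/-- The subalgebras generated by the two multiplication operators. -/
noncomputable def fockAlgebra (μ : Fin 2 → Distribution) :=
  generated (mulOp.{u} μ 0) (mulOp μ 1)

theorem exists_of_mem_centered (hμ : ∀ i, μ i 1 = 1) {i : Fin 2}
    {c : Module.End ℂ FockSpace.{u}}
    (hc : c ∈ centered (vacuumState vacuum) (fockAlgebra μ) i) :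
    ∃ q : Polynomial ℂ, μ i q = 0 ∧ c = Polynomial.aeval (mulOp μ i) q := by
  obtain ⟨h1, h2⟩ := mem_centered.1 hc
  have h1 : c ∈ Algebra.adjoin ℂ {mulOp μ i} := by
    fin_cases i <;> exact h1
  rw [Algebra.adjoin_singleton_eq_range_aeval] at h1
  obtain ⟨q, rfl⟩ := h1
  refine ⟨q, ?_, rfl⟩
  rw [← law_vacuum hμ i]
  exact h2

theorem notHead_nil (i : Fin 2) : NotHead i ([] : List Letter.{u}) := by simp [NotHead]

/-- Each factor creates one letter. The condition on w keeps the rightmost factor, which acts first,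
from merging with the head of w. -/
theorem word_ket (hμ : ∀ i, μ i 1 = 1) (n : ℕ) (i : Fin 2)
    (f : ℕ → Module.End ℂ FockSpace.{u})
    (hf : ∀ k, f k ∈ centered (vacuumState vacuum) (fockAlgebra μ) (alt i k)) :
    word n f (ket []) ∈ startSpan i n ∧ ∀ w, NotHead (alt i n) w →
      word n f (ket w) = appendWord w (word n f (ket [])) := by
  obtain ⟨q, hq, hq'⟩ := exists_of_mem_centered hμ (hf 0)
  rw [alt_zero] at hq hq'
  induction n generalizing i f q with
  | zero =>
    rw [word, hq', aeval_mulOp_ket hμ (notHead_nil i), hq, zero_smul, zero_add]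
    refine ⟨consPoly_mem i [] q, fun w hw => ?_⟩
    rw [alt_zero] at hw
    rw [aeval_mulOp_ket hμ hw, hq, zero_smul, zero_add, appendWord_consPoly, List.nil_append]
  | succ n ih =>
    have hf' : ∀ k, f (k + 1) ∈ centered (vacuumState vacuum) (fockAlgebra μ) (alt (i + 1) k) :=
      fun k => by rw [← alt_succ]; exact hf (k + 1)
    obtain ⟨r, hr, hr'⟩ := exists_of_mem_centered hμ (hf' 0)
    rw [alt_zero] at hr hr'
    obtain ⟨h1, h2⟩ := ih (i + 1) (fun k => f (k + 1)) hf' r hr hr'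
    obtain ⟨h3, h4⟩ := centered_apply_startSpan hμ hq h1
    rw [word, hq']
    refine ⟨h3, fun w hw => ?_⟩
    rw [alt_succ] at hw
    rw [Module.End.mul_apply, Module.End.mul_apply, h2 w hw, h4]

/-- By linearity in q this reduces to `infWeight_cons_append` on powers; the product of means in the
covariance disappears because q is centered. -/
theorem infFunctional_append (hμ : ∀ i, μ i 1 = 1) {i : Fin 2} {q : Polynomial ℂ}
    (hq : μ i q = 0) (k : ℕ) {n : ℕ} (hn : Even n) {y : FockSpace.{u}}
    (hy : y ∈ startSpan (i + 1) n) :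
    infFunctional μ μ' (appendWord [(i, ⟨k⟩)] (Polynomial.aeval (mulOp μ i) q y)) =
      μ i (q * Polynomial.X ^ (k + 1)) * infFunctional μ μ' y := by
  refine Submodule.span_induction (p := fun y _ =>
    infFunctional μ μ' (appendWord [(i, ⟨k⟩)] (Polynomial.aeval (mulOp μ i) q y)) =
      μ i (q * Polynomial.X ^ (k + 1)) * infFunctional μ μ' y) ?_ (by simp)
    (fun x y _ _ hx hy => by simp only [map_add, hx, hy, mul_add])
    (fun c x _ hx => by simp only [map_smul, hx, smul_eq_mul]; ring) hy
  rintro _ ⟨a, v, rfl, rfl⟩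
  rw [aeval_mulOp_ket hμ (by simp [NotHead]), hq, zero_smul, zero_add, appendWord_consPoly,
    infFunctional_ket]
  set w : List Letter.{u} := (i + 1, a) :: v with hw
  have hodd : Odd w.length := by simpa [hw] using hn.add_one
  have : infFunctional μ μ' ∘ₗ consPoly i (w ++ [(i, ⟨k⟩)]) =
      infWeight μ μ' w • (μ i ∘ₗ LinearMap.mulRight ℂ (Polynomial.X ^ (k + 1)) -
        μ i (Polynomial.X ^ (k + 1)) • μ i) := by
    refine polynomial_lhom_ext ?_ fun n => ?_
    · simp [consPoly_one, hμ]
    · rw [LinearMap.comp_apply, consPoly_X_pow, infFunctional_ket, infWeight_cons_append _ _ hodd]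
      simp only [covariance, LinearMap.smul_apply, LinearMap.sub_apply, LinearMap.comp_apply,
        LinearMap.mulRight_apply, smul_eq_mul]
      ring
  have := LinearMap.congr_fun this q
  simp only [LinearMap.smul_apply, LinearMap.sub_apply, LinearMap.comp_apply,
    LinearMap.mulRight_apply, smul_eq_mul, hq, mul_zero, sub_zero] at this
  rw [this, mul_comm]

/-- The two multiplication operators are infinitesimally free. -/
theorem infinitesimallyFree_fock (hμ : ∀ i, μ i 1 = 1) :
    InfinitesimallyFree (B := Module.End ℂ FockSpace.{u}) (vacuumState vacuum) (vacuumState (infFunctional μ μ'))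
      (fockAlgebra μ) := by
  rw [infinitesimallyFree_iff]
  intro n i f hf
  have hmem := (word_ket hμ n i f hf).1
  refine ⟨?_, ?_⟩
  · rw [vacuumState_apply]
    refine Submodule.span_induction (p := fun y _ => vacuum y = 0) ?_ (by simp)
      (fun x y _ _ hx hy => by rw [map_add, hx, hy, add_zero])
      (fun c x _ hx => by rw [map_smul, hx, smul_zero]) hmem
    rintro _ ⟨k, w, rfl, rfl⟩
    simp [vacuum, ket]
  · by_cases hn : Even n
    · rw [if_pos hn]
      clear hmem
      obtain ⟨m, rfl⟩ := hn.two_dvd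
      clear hn
      induction m generalizing i f with
      | zero => simp [word, pairing]
      | succ m ih =>
        have hf' : ∀ k, f (k + 1) ∈
            centered (vacuumState vacuum) (fockAlgebra μ) (alt (i + 1) k) :=
          fun k => by rw [← alt_succ]; exact hf (k + 1)
        have hlast := hf (2 * m + 2)
        have halt : alt i (2 * m + 2) = i := by simp [alt, Nat.even_add]
        rw [halt] at hlast
        obtain ⟨q, hq, hq'⟩ := exists_of_mem_centered hμ (hf 0)
        rw [alt_zero] at hq hq'
        obtain ⟨r, hr, hr'⟩ := exists_of_mem_centered hμ hlast
        obtain ⟨h1, h2⟩ := word_ket hμ (2 * m) (i + 1) (fun k => f (k + 1)) hf'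
        -- The rightmost factor turns the empty word into its centered polynomial. The identity is
        -- linear in that polynomial, so powers suffice, and for them the inner word acts by
        -- concatenation.
        have key : infFunctional μ μ' ∘ₗ (f 0 : FockSpace →ₗ[ℂ] FockSpace) ∘ₗ
            (word (2 * m) fun k => f (k + 1) : FockSpace →ₗ[ℂ] FockSpace) ∘ₗ consPoly i [] =
            infFunctional μ μ' (word (2 * m) (fun k => f (k + 1)) (ket [])) •
              (μ i ∘ₗ LinearMap.mulLeft ℂ q) := by
          refine polynomial_lhom_ext ?_ fun k => ?_
          · simp [consPoly_one, hq]
          · simp only [LinearMap.comp_apply, consPoly_X_pow, LinearMap.smul_apply,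
              LinearMap.mulLeft_apply, smul_eq_mul]
            have hne : NotHead (alt (i + 1) (2 * m)) [((i, ⟨k⟩) : Letter.{u})] := by
              have : alt (i + 1) (2 * m) = i + 1 := by simp [alt]
              rw [this]
              intro x hx
              obtain rfl : (i, ⟨k⟩) = x := by simpa using hx
              exact (add_one_ne i).symm
            rw [h2 _ hne, hq', (centered_apply_startSpan hμ hq h1).2,
              infFunctional_append hμ hq k (even_two_mul m) h1, mul_comm]
        rw [show 2 * (m + 1) = 2 * m + 2 by ring, pairing_add_two, ← ih (i + 1) _ hf',
          vacuumState_apply, vacuumState_apply, word, word_succ_right, Module.End.mul_apply,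
          Module.End.mul_apply, hr', aeval_mulOp_ket hμ (notHead_nil i), hr, zero_smul, zero_add]
        have e := LinearMap.congr_fun key r
        simp only [LinearMap.comp_apply, LinearMap.smul_apply, LinearMap.mulLeft_apply,
          smul_eq_mul] at e
        rw [e, hq', ← map_mul, mul_comm, ← law_vacuum hμ i]
        rfl
    · rw [if_neg hn, vacuumState_apply]
      refine Submodule.span_induction (p := fun y _ => infFunctional μ μ' y = 0) ?_ (by simp)
        (fun x y _ _ hx hy => by rw [map_add, hx, hy, add_zero])
        (fun c x _ hx => by rw [map_smul, hx, smul_zero]) hmem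
      rintro _ ⟨k, w, rfl, rfl⟩
      rw [infFunctional_ket, infWeight, if_neg]
      simpa [Nat.odd_add_one] using hn

end Fock

/-! ### The realization and the conclusion -/

theorem exists_infFreeRealization {μ₁ μ₁' μ₂ μ₂' : Distribution} (h₁ : μ₁ 1 = 1) (h₂ : μ₂ 1 = 1)
    (h₁' : μ₁' 1 = 0) (h₂' : μ₂' 1 = 0) :
    ∃ (B : Type u) (_ : Ring B) (_ : Algebra ℂ B) (φ φ' : B →ₗ[ℂ] ℂ) (b₁ b₂ : B),
      InfFreeRealization (μ₁, μ₁') (μ₂, μ₂') φ φ' b₁ b₂ := by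
  have hμ : ∀ i, (![μ₁, μ₂] : Fin 2 → Distribution) i 1 = 1 := by
    intro i; fin_cases i <;> assumption
  have hμ' : ∀ i, (![μ₁', μ₂'] : Fin 2 → Distribution) i 1 = 0 := by
    intro i; fin_cases i <;> assumption
  have l := law_vacuum.{u} hμ
  have l' := law_infFunctional.{u} hμ hμ'
  refine ⟨Module.End ℂ FockSpace.{u}, inferInstance, inferInstance, vacuumState vacuum,
    vacuumState (infFunctional ![μ₁, μ₂] ![μ₁', μ₂']), mulOp ![μ₁, μ₂] 0, mulOp ![μ₁, μ₂] 1,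
    ?_, ?_, ?_, ?_, infinitesimallyFree_fock hμ⟩
  · rw [← law_one _ (mulOp ![μ₁, μ₂] 0), l]; exact h₁
  · rw [← law_one _ (mulOp ![μ₁, μ₂] 0), l']; exact h₁'
  · rw [l, l']; rfl
  · rw [l, l']; rfl

end InfFree

theorem proposition5p6 (μ₁ μ₂ τ₁ τ₂ : InfFree.Distribution)
    (hμ₁ : μ₁ 1 = 1) (hμ₂ : μ₂ 1 = 1)
    (hτ₁ : InfFree.IsInverseMarkovKrein μ₁ τ₁) (hτ₂ : InfFree.IsInverseMarkovKrein μ₂ τ₂) :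
    (∃! μ : InfFree.Distribution, InfFree.IsFreeMulConv.{u} μ₁ μ₂ μ) ∧
    ∀ μ τ : InfFree.Distribution,
      InfFree.IsFreeMulConv.{u} μ₁ μ₂ μ → InfFree.IsInverseMarkovKrein μ τ →
        InfFree.IsInfFreeMulConv.{u} (μ₁, μ₁ - τ₁) (μ₂, μ₂ - τ₂) (μ, μ - τ) := by
  obtain ⟨B, hB, hB', φ, φ', b₁, b₂, H⟩ := InfFree.exists_infFreeRealization.{u}
    (μ₁' := μ₁ - τ₁) (μ₂' := μ₂ - τ₂) hμ₁ hμ₂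
    (by simp [hμ₁, hτ₁.apply_one hμ₁]) (by simp [hμ₂, hτ₂.apply_one hμ₂])
  refine ⟨⟨InfFree.law φ (b₁ * b₂), ⟨⟨B, hB, hB', φ, b₁, b₂, H.freeRealization⟩, ?_⟩, ?_⟩, ?_⟩
  · intro A _ _ ψ a₁ a₂ K
    exact InfFree.law_mul_eq hμ₁ hμ₂ K H.freeRealization
  · intro ν hν
    exact (hν.2 B φ b₁ b₂ H.freeRealization).symm
  · intro μ τ hμ hτ
    refine ⟨⟨B, hB, hB', φ, φ', b₁, b₂, H⟩, ?_⟩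
    intro C _ _ ψ ψ' c₁ c₂ K
    have e := hμ.2 C ψ c₁ c₂ K.freeRealization
    have k := InfFree.isInverseMarkovKrein_mul hμ₁ hμ₂ hτ₁ hτ₂ K
    have h1 : μ 1 = 1 := by rw [← e, InfFree.law_one, K.unital]
    rw [e] at k
    -- Uniqueness of the transform identifies μ minus the φ'-distribution of the product with τ.
    have := (InfFree.existsUnique_inverseMarkovKrein μ h1).unique k hτ
    rw [e, ← this, sub_sub_cancel]
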